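/- **Theorem.** Conventions. For a set $X\subset\mathbb{R}^n$ the packing radius $r_X$ is half the infimum of the distances between distinct points of $X$, and the covering radius $R_X$ is the supremum over $c\in\mathbb{R}^n$ of the distance from $c$ to $X$. $X$ is a *Delone set* if $r_X>0$ and $R_X<\infty$, and a *Meyer set* if both $X$ and $X-X$ are Delone sets. $X$ is *aperiodic* if $X+t=X$ only for $t=0$. The $T$-patch of $X$ at $x\in X$ is $\mathcal P_X(x;T)=X\cap B(x;T)$ ($B$ the open ball); the patches at $x$ and $y$ are equivalent if $\mathcal P_X(y;T)=\mathcal P_X(x;T)+y-x$. $N_X(T)$ is the number (possibly infinite) of equivalence classes of $T$-patches centered at points of $X$, and $M_X(T)$ is the least $M$ (possibly infinite) such that every closed ball of radius $M$ contains, for each $T$-patch of $X$, the center of an equivalent $T$-patch of $X$. $X$ is *repetitive* if $M_X(T)<\infty$ for all $T>0$. $X$ has *uniform patch frequencies* if for every $T>0$ and $x\in X$ there is a number $f$ such that, as $L\to\infty$, the number of $y\in X\cap B(c;L)$ whose $T$-patch is equivalent to that of $x$, divided by $\operatorname{vol}B(c;L)$, tends to $f$ uniformly in $c\in\mathbb{R}^n$.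 Let $\kappa(n)$ be the infimum of $R_X/r_X$ over all Delone sets $X\subset\mathbb{R}^n$, and $\kappa_L(n)$ the infimum of $R_\Lambda/r_\Lambda$ over all full rank lattices $\Lambda\subset\mathbb{R}^n$. Let $n\ge 1$ and $\varepsilon>0$. (i) There exists an aperiodic Delone set $X\subset\mathbb{R}^n$ for which there is a $T>0$ such that $$N_X(T)<\Bigl(\tfrac12\kappa(n)+\varepsilon\Bigr)\frac{T}{R_X}\quad\text{and}\quad M_X(T)<\Bigl(\tfrac12\kappa(n)+\varepsilon\Bigr)T.$$ (ii) There exists an aperiodic repetitive Meyer set $Z\subset\mathbb{R}^n$ having uniform patch frequencies for which there is a $T>0$ such that $$N_Z(T)<\Bigl(\tfrac12\kappa_L(n)+\varepsilon\Bigr)\frac{T}{R_Z}\quad\text{and}\quad M_Z(T)<\Bigl(\tfrac12\kappa_L(n)+\varepsilon\Bigr)T.$$ Moreover $Z$ can be taken to be a perturbed lattice, i.e. $Z=\{\lambda+\langle\phi(\lambda)\rangle\delta:\lambda\in\Lambda\}$ for a full rank lattice $\Lambda$, a linear functional $\phi$ on $\mathbb{R}^n$ and a vector $\delta\in\mathbb{R}^n$,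 where $\langle t\rangle=t-\lfloor t\rfloor$, and at the same time a cut-and-project set: there are a full rank lattice $L\subset\mathbb{R}^n\times\mathbb{R}$, projecting injectively to $\mathbb{R}^n$ and onto a dense subset of $\mathbb{R}$, and an interval $[a,b)$ with $a<b$ such that $Z=\{x:(x,s)\in L,\ s\in[a,b)\}$. -/

import Mathlib

open scoped ENNReal

namespace Delone

noncomputable section

section Metric

variable {E : Type*} [NormedAddCommGroup E]

/-- The packing radius `r` of a point set: half of the infimum of the distances between distinct
points, i.e. the largest `r` such that the open balls of radius `r` about the points are disjoint. -/
def packingRadius (X : Set E) : ℝ≥0∞ := X.einfsep / 2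

/-- The covering radius `R` of a point set: the supremum over all points of space of the
distance to the set, i.e. the least radius of closed balls about the points that cover space. -/
def coveringRadius (X : Set E) : ℝ≥0∞ := ⨆ c : E, Metric.infEDist c X

/-- A Delone set: positive packing radius and finite covering radius. -/
def IsDelone (X : Set E) : Prop := 0 < packingRadius X ∧ coveringRadius X < ⊤

/-- The packing-covering ratio `R / r` (a real number for Delone sets in dimension at least 1). -/
def packingCoveringRatio (X : Set E) : ℝ := (coveringRadius X).toReal / (packingRadius X).toReal

/-- An aperiodic set: no nonzero translation maps the set onto itself. -/
def IsAperiodic (X : Set E) : Prop := ∀ t : E, (fun x => x + t) '' X = X → t = 0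

/-- A Meyer set: a Delone set whose set of differences is also a Delone set. -/
def IsMeyer (X : Set E) : Prop :=
  IsDelone X ∧ IsDelone {d : E | ∃ x ∈ X, ∃ y ∈ X, d = x - y}

/-- The `T`-patch of `X` centered at `x`. -/
def patch (X : Set E) (T : ℝ) (x : E) : Set E := X ∩ Metric.ball x T

/-- Translation equivalence of the `T`-patches centered at `x` and at `y`. -/
def PatchEquiv (X : Set E) (T : ℝ) (x y : E) : Prop :=
  patch X T y = (fun z => z + (y - x)) '' patch X T x

/-- The centers in `X` of the `T`-patches that are translation equivalent to the one at `x`. -/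
def patchClass (X : Set E) (T : ℝ) (x : E) : Set E := {y ∈ X | PatchEquiv X T x y}

/-- The patch-counting function `N_X(T)`: the number (possibly infinite) of
translation-inequivalent `T`-patches centered at points of `X`. -/
def patchCount (X : Set E) (T : ℝ) : ℕ∞ := (patchClass X T '' X).encard

/-- The repetitivity function `M_X(T)`: the least `M` (possibly infinite) such that every closed
ball of radius `M` contains the center of a translate of each `T`-patch that occurs in `X`. -/
def repetitivity (X : Set E) (T : ℝ) : ℝ≥0∞ :=
  sInf {M : ℝ≥0∞ | ∀ c : E, ∀ x ∈ X, ∃ y ∈ patchClass X T x, edist y c ≤ M}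

/-- A repetitive set: `M_X(T)` is finite for all `T`. -/
def IsRepetitive (X : Set E) : Prop := ∀ T : ℝ, 0 < T → repetitivity X T < ⊤

/-- Uniform patch frequencies: for every patch that occurs in `X`, the number of its occurrences
with center in the ball `B(c; L)`, divided by the volume of that ball, converges
as `L → ∞`, uniformly in `c`, to a limit that does not depend on `c`. -/
def HasUniformPatchFrequencies [MeasureTheory.MeasureSpace E] (X : Set E) : Prop :=
  ∀ T : ℝ, 0 < T → ∀ x ∈ X, ∃ f : ℝ,
    TendstoUniformly
      (fun (L : ℝ) (c : E) =>
        ((patchClass X T x ∩ Metric.ball c L).ncard : ℝ) /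
          (MeasureTheory.volume (Metric.ball c L)).toReal)
      (fun _ => f) Filter.atTop

end Metric

section Lattice

variable {E : Type*} [NormedAddCommGroup E] [NormedSpace ℝ E]

/-- A (full rank) lattice: a discrete additive subgroup that spans the space over `ℝ`. -/
def IsLattice (L : Submodule ℤ E) : Prop :=
  ∃ _ : DiscreteTopology L, IsZLattice ℝ L

/-- A perturbed lattice `{λ + ⟨φ(λ)⟩ δ : λ ∈ Λ}`, where `Λ` is a lattice, `φ` a linear functional,
`δ` a vector, and `⟨t⟩` is the fractional part of `t`. -/
def IsPerturbedLattice (Z : Set E) : Prop :=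
  ∃ L : Submodule ℤ E, IsLattice L ∧ ∃ (φ : E →ₗ[ℝ] ℝ) (δ : E),
    Z = (fun v => v + Int.fract (φ v) • δ) '' (L : Set E)

/-- A cut-and-project set with physical space `E`, one-dimensional internal space `ℝ` and a
half-open interval `[a, b)` as window: the lattice `L` of `E × ℝ` projects injectively to the
physical space and densely to the internal space. -/
def IsCutAndProject (Z : Set E) : Prop :=
  ∃ L : Submodule ℤ (E × ℝ), IsLattice L ∧ Set.InjOn Prod.fst (L : Set (E × ℝ)) ∧
    Dense (Prod.snd '' (L : Set (E × ℝ))) ∧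
    ∃ a b : ℝ, a < b ∧ Z = Prod.fst '' {l : E × ℝ | l ∈ L ∧ l.2 ∈ Set.Ico a b}

end Lattice

/-- The Delone packing-covering constant `κ(n)`. -/
def kappa (n : ℕ) : ℝ :=
  sInf {k : ℝ | ∃ X : Set (EuclideanSpace ℝ (Fin n)), IsDelone X ∧ k = packingCoveringRatio X}

/-- The lattice packing-covering constant `κ_L(n)`. -/
def kappaL (n : ℕ) : ℝ :=
  sInf {k : ℝ | ∃ L : Submodule ℤ (EuclideanSpace ℝ (Fin n)), IsLattice L ∧
    k = packingCoveringRatio (L : Set (EuclideanSpace ℝ (Fin n)))}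

end

end Delone

/-! Take `T = 2r`. An open ball of radius `2r` about a point of `X` contains no other point of `X`,
so every `T`-patch is a single point: `N_X(T) = 1` and `M_X(T)` is at most every `M > R`. Both
bounds with factor `k` then follow from `R / r < 2k`, and for `k = κ/2 + ε` this reads `R / r < κ +
2ε` (`IsDelone.exists_patchCount_lt_and_repetitivity_lt`). What remains is to find a set of the
required kind with nearly optimal ratio. Small displacements keep `R / r` below a strict bound
(`IsDelone.exists_perturbation`).

For (i), displace one point of a nearly optimal Delone set if that set is periodic
(`IsDelone.exists_isAperiodic`).

For (ii), replace each `v` of a nearly optimal lattice by `v + ⟨φ v⟩ δ` with `δ` small and `φ`, `δ`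
generic (`exists_isGeneric`). The displacement from the point at `u` to the one at `u + w` depends
only on `w` and on whether `⟨φ u⟩ < 1 - ⟨φ w⟩`. So a patch class corresponds to the lattice vectors
whose `⟨φ v⟩` lies in an interval between two thresholds (`IsGeneric.patchClass_eq`,
`exists_sameSide_iff`). The indicator of `⟨φ v⟩ < 1 - ⟨φ u⟩` is the constant `1 - ⟨φ u⟩` plus the
coboundary `⟨φ (v + u)⟩ - ⟨φ v⟩`. Its sum over a ball thus has only a boundary error
(`exists_abs_ncard_sub_le`), which yields uniform positive frequencies without an equidistribution
theorem. Repetitivity follows, as there are finitely many classes. -/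

namespace Delone

/-! ### Packing and covering radii, small displacements, and the choice of `T`. -/

section PackingCovering

variable {E : Type*} [NormedAddCommGroup E] {X : Set E}

theorem ofReal_le_packingRadius {ρ : ℝ} (h : ∀ x ∈ X, ∀ y ∈ X, x ≠ y → 2 * ρ ≤ dist x y) :
    ENNReal.ofReal ρ ≤ packingRadius X := by
  unfold packingRadius
  rw [ENNReal.le_div_iff_mul_le (by simp) (by simp)]
  refine Set.le_einfsep fun x hx y hy hxy => ?_
  rw [edist_dist, mul_comm, show (2 : ℝ≥0∞) = ENNReal.ofReal 2 by simp,
    ← ENNReal.ofReal_mul (by norm_num)]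
  exact ENNReal.ofReal_le_ofReal (h x hx y hy hxy)

theorem coveringRadius_le_ofReal {ρ : ℝ} (h : ∀ c, ∃ y ∈ X, dist c y ≤ ρ) :
    coveringRadius X ≤ ENNReal.ofReal ρ := by
  refine iSup_le fun c => ?_
  obtain ⟨y, hy, hcy⟩ := h c
  refine (Metric.infEDist_le_edist_of_mem hy).trans ?_
  rw [edist_dist]
  exact ENNReal.ofReal_le_ofReal hcy

theorem two_mul_packingRadius_le_edist {x y : E} (hx : x ∈ X) (hy : y ∈ X) (hxy : x ≠ y) :
    2 * packingRadius X ≤ edist x y := by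
  unfold packingRadius
  rw [ENNReal.mul_div_cancel (by simp) (by simp)]
  exact Set.einfsep_le_edist_of_mem hx hy hxy

theorem IsDelone.exists_dist_lt (hX : IsDelone X) {ρ : ℝ} (hρ : (coveringRadius X).toReal < ρ)
    (c : E) : ∃ y ∈ X, dist c y < ρ := by
  have h1 : Metric.infEDist c X < ENNReal.ofReal ρ :=
    (le_iSup (fun c => Metric.infEDist c X) c).trans_lt
      ((ENNReal.lt_ofReal_iff_toReal_lt hX.2.ne).2 hρ)
  obtain ⟨y, hy, h2⟩ := Metric.infEDist_lt_iff.1 h1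
  exact ⟨y, hy, (edist_lt_ofReal).1 h2⟩

theorem IsDelone.nonempty (hX : IsDelone X) : X.Nonempty :=
  let ⟨y, hy, _⟩ := hX.exists_dist_lt (lt_add_one _) 0
  ⟨y, hy⟩

theorem two_mul_packingRadius_toReal_le_dist {x y : E} (hx : x ∈ X)
    (hy : y ∈ X) (hxy : x ≠ y) : 2 * (packingRadius X).toReal ≤ dist x y := by
  have h := ENNReal.toReal_mono (edist_ne_top x y) (two_mul_packingRadius_le_edist hx hy hxy)
  simpa [edist_dist, dist_nonneg] using h

theorem isDelone_of_dist {r R : ℝ} (hr : 0 < r)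
    (hpack : ∀ x ∈ X, ∀ y ∈ X, x ≠ y → 2 * r ≤ dist x y) (hcov : ∀ c, ∃ y ∈ X, dist c y ≤ R) :
    IsDelone X :=
  ⟨(ENNReal.ofReal_pos.2 hr).trans_le (ofReal_le_packingRadius hpack),
    (coveringRadius_le_ofReal hcov).trans_lt ENNReal.ofReal_lt_top⟩

variable [NormedSpace ℝ E]

/-- Moving a single point of a periodic Delone set to a place outside the set makes it
aperiodic. -/
theorem isAperiodic_update_image [DecidableEq E] (hX : ¬ IsAperiodic X) {x x' : E} (hx : x ∈ X)
    (hx' : x' ∉ X) : IsAperiodic (Function.update id x x' '' X) := by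
  have himage : Function.update id x x' '' X = insert x' (X \ {x}) := by
    ext y
    simp only [Set.mem_image, Set.mem_insert_iff, Set.mem_sdiff, Set.mem_singleton_iff]
    constructor
    · rintro ⟨z, hz, rfl⟩
      by_cases hzx : z = x
      · subst hzx
        simp
      · simp [hzx, hz]
    · rintro (rfl | ⟨hy, hyx⟩)
      · exact ⟨x, hx, by simp⟩
      · exact ⟨y, hy, by simp [hyx]⟩
  rw [himage]
  unfold IsAperiodic at hX
  push Not at hX
  obtain ⟨t, ht, ht0⟩ := hX
  have htX : ∀ y, y ∈ X → y + t ∈ X := fun y hy => ht ▸ Set.mem_image_of_mem (· + t) hy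
  have htX' : ∀ y, y + t ∈ X → y ∈ X := by
    intro y hy
    rw [← ht] at hy
    obtain ⟨z, hz, hzy⟩ := hy
    rwa [← add_right_cancel hzy]
  intro s hs
  by_contra hs0
  have hsY : ∀ y, y ∈ insert x' (X \ {x}) → y + s ∈ insert x' (X \ {x}) :=
    fun y hy => hs ▸ Set.mem_image_of_mem (· + s) hy
  have hsY' : ∀ y, y + s ∈ insert x' (X \ {x}) → y ∈ insert x' (X \ {x}) := by
    intro y hy
    rw [← hs] at hy
    obtain ⟨z, hz, hzy⟩ := hy
    rwa [← add_right_cancel hzy]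
  have h2s : s + s ≠ 0 := by
    rw [← two_smul ℝ]
    exact smul_ne_zero two_ne_zero hs0
  have h1 := hsY x' (Set.mem_insert _ _)
  have h2 := hsY _ h1
  have h1X : x' + s ∈ X := by
    rcases h1 with h1 | h1
    · exact absurd (add_eq_left.1 h1) hs0
    · exact h1.1
  have h2X : x' + s + s ∈ X := by
    rcases h2 with h2 | h2
    · rw [add_assoc] at h2
      exact absurd (add_eq_left.1 h2) h2s
    · exact h2.1
  -- Go from `x'` by `s` into `X`, shift by `t`, and come back by `s`. This fails only if `x' + s +
  -- t` is the removed point `x`; then take two steps of `s` instead of one.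
  have key : x' + t ∈ insert x' (X \ {x}) := by
    by_cases hxs : x' + s + t = x
    · have h3 : x' + t + s + s ∈ insert x' (X \ {x}) := by
        refine Or.inr ⟨?_, fun h => ?_⟩
        · have := htX _ h2X
          rwa [show x' + t + s + s = x' + s + s + t by abel]
        · rw [Set.mem_singleton_iff, ← hxs, show x' + t + s + s = x' + s + t + s by abel] at h
          exact hs0 (add_eq_left.1 h)
      exact hsY' _ (hsY' _ h3)
    · refine hsY' _ (Or.inr ⟨?_, fun h => hxs ?_⟩)
      · have := htX _ h1X
        rwa [show x' + t + s = x' + s + t by abel]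
      · rw [Set.mem_singleton_iff] at h
        rw [← h]
        abel
  rcases key with h | h
  · exact ht0 (add_eq_left.1 h)
  · exact hx' (htX' _ h.1)

variable [Nontrivial E]

theorem IsDelone.packingRadius_lt_top (hX : IsDelone X) : packingRadius X < ⊤ := by
  obtain ⟨x, hx⟩ := hX.nonempty
  obtain ⟨v, hv⟩ := NormedSpace.exists_lt_norm ℝ E ((coveringRadius X).toReal + 1)
  obtain ⟨y, hy, hxy⟩ := hX.exists_dist_lt (lt_add_one _) (x + v)
  have hne : x ≠ y := by
    rintro rfl
    rw [dist_eq_norm, add_sub_cancel_left] at hxy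
    linarith
  have h := two_mul_packingRadius_le_edist hx hy hne
  by_contra! htop
  rw [top_le_iff.1 htop, ENNReal.mul_top (by simp)] at h
  exact edist_ne_top x y (top_le_iff.1 h)

theorem IsDelone.packingRadius_toReal_pos (hX : IsDelone X) : 0 < (packingRadius X).toReal :=
  ENNReal.toReal_pos hX.1.ne' hX.packingRadius_lt_top.ne

theorem IsDelone.coveringRadius_toReal_pos (hX : IsDelone X) : 0 < (coveringRadius X).toReal := by
  by_contra! h0
  have h0 := le_antisymm h0 ENNReal.toReal_nonneg
  obtain ⟨x, hx⟩ := hX.nonempty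
  have hr := hX.packingRadius_toReal_pos
  set r := (packingRadius X).toReal
  obtain ⟨v, hv⟩ := exists_norm_eq E hr.le
  obtain ⟨y, hy, hxy⟩ := hX.exists_dist_lt (ρ := r / 2) (by linarith) (x + v)
  have hd : dist x (x + v) = r := by rw [dist_eq_norm, sub_add_cancel_left, norm_neg, hv]
  have hne : x ≠ y := by
    rintro rfl
    rw [dist_comm] at hxy
    linarith
  have h1 := two_mul_packingRadius_toReal_le_dist hx hy hne
  have h2 := dist_triangle x (x + v) y
  linarith

theorem packingCoveringRatio_le_of_dist {r R : ℝ} (hr : 0 < r)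
    (hpack : ∀ x ∈ X, ∀ y ∈ X, x ≠ y → 2 * r ≤ dist x y) (hcov : ∀ c, ∃ y ∈ X, dist c y ≤ R) :
    packingCoveringRatio X ≤ R / r := by
  have hX := isDelone_of_dist hr hpack hcov
  have hR : 0 ≤ R := by
    obtain ⟨y, -, hy⟩ := hcov 0
    exact dist_nonneg.trans hy
  refine div_le_div₀ hR ?_ hr ?_
  · exact ENNReal.toReal_le_of_le_ofReal hR (coveringRadius_le_ofReal hcov)
  · exact (ENNReal.ofReal_le_iff_le_toReal hX.packingRadius_lt_top.ne).1
      (ofReal_le_packingRadius hpack)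

/-- A Delone set whose packing-covering ratio is less than `k` may be moved a little without
losing these properties. -/
theorem IsDelone.exists_perturbation (hX : IsDelone X) {k : ℝ} (hk : packingCoveringRatio X < k) :
    ∃ η > 0, ∀ f : E → E, (∀ x ∈ X, dist (f x) x ≤ η) →
      IsDelone (f '' X) ∧ packingCoveringRatio (f '' X) < k := by
  have hr := hX.packingRadius_toReal_pos
  have hR := hX.coveringRadius_toReal_pos
  have hpd := fun x hx y hy hxy =>
    two_mul_packingRadius_toReal_le_dist (X := X) (x := x) (y := y) hx hy hxy
  have hcd := fun ρ hρ c => hX.exists_dist_lt (ρ := ρ) hρ c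
  unfold packingCoveringRatio at hk
  set r := (packingRadius X).toReal
  set R := (coveringRadius X).toReal
  rw [div_lt_iff₀ hr] at hk
  have hkpos : 0 < k := by
    by_contra! hk0
    nlinarith
  obtain ⟨η, hη, hηr, hηk⟩ : ∃ η > 0, η < r ∧ R + 2 * η < k * (r - η) := by
    -- The second inequality amounts to `(2 + k) η < k r - R`; half of the critical value makes it
    -- strict.
    refine ⟨min (r / 2) ((k * r - R) / (2 * (2 + k))), ?_, ?_, ?_⟩
    · exact lt_min (by positivity) (div_pos (by linarith) (by positivity))
    · exact (min_le_left _ _).trans_lt (by linarith)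
    · have h := min_le_right (r / 2) ((k * r - R) / (2 * (2 + k)))
      rw [le_div_iff₀ (by positivity)] at h
      nlinarith
  refine ⟨η, hη, fun f hf => ?_⟩
  have hpack : ∀ x ∈ f '' X, ∀ y ∈ f '' X, x ≠ y → 2 * (r - η) ≤ dist x y := by
    rintro _ ⟨x, hx, rfl⟩ _ ⟨y, hy, rfl⟩ hxy
    have h1 := hpd x hx y hy (fun h => hxy (by rw [h]))
    have h2 := dist_triangle4 x (f x) (f y) y
    have h3 := hf x hx
    have h4 := hf y hy
    rw [dist_comm] at h3
    linarith
  -- One `η` pays for the displacement, the other for the fact that the distance to `X` need not be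
  -- attained.
  have hcov : ∀ c, ∃ y ∈ f '' X, dist c y ≤ R + 2 * η := by
    intro c
    obtain ⟨y, hy, hcy⟩ := hcd (R + η) (by linarith) c
    refine ⟨f y, ⟨y, hy, rfl⟩, ?_⟩
    have h2 := dist_triangle c y (f y)
    have h3 := hf y hy
    rw [dist_comm] at h3
    linarith
  have hr' : 0 < r - η := by linarith
  refine ⟨isDelone_of_dist hr' hpack hcov,
    (packingCoveringRatio_le_of_dist hr' hpack hcov).trans_lt ?_⟩
  rw [div_lt_iff₀ hr']
  exact hηk

/-- If `T` is twice the packing radius then all `T`-patches are single points. -/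
theorem IsDelone.patchClass_eq (hX : IsDelone X) {x : E} (hx : x ∈ X) :
    patchClass X (2 * (packingRadius X).toReal) x = X := by
  have hr := hX.packingRadius_toReal_pos
  have hpatch : ∀ y ∈ X, patch X (2 * (packingRadius X).toReal) y = {y} := by
    intro y hy
    ext z
    simp only [patch, Set.mem_inter_iff, Metric.mem_ball, Set.mem_singleton_iff]
    refine ⟨fun ⟨hz, hzy⟩ => ?_, ?_⟩
    · by_contra hne
      exact (two_mul_packingRadius_toReal_le_dist hz hy hne).not_gt hzy
    · rintro rfl
      exact ⟨hy, by rw [dist_self]; positivity⟩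
  ext y
  simp only [patchClass, PatchEquiv, Set.mem_ofPred_eq, and_iff_left_iff_imp]
  intro hy
  rw [hpatch x hx, hpatch y hy]
  simp

/-- With `T = 2r` there is only one patch class, `X` itself, so both bounds reduce to `R < k T`. -/
theorem IsDelone.exists_patchCount_lt_and_repetitivity_lt (hX : IsDelone X) {k : ℝ}
    (hk : packingCoveringRatio X < 2 * k) :
    ∃ T : ℝ, 0 < T ∧
      (patchCount X T : ℝ≥0∞) < ENNReal.ofReal (k * (T / (coveringRadius X).toReal)) ∧
      repetitivity X T < ENNReal.ofReal (k * T) := by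
  have hr := hX.packingRadius_toReal_pos
  have hR := hX.coveringRadius_toReal_pos
  have hk' : (coveringRadius X).toReal < k * (2 * (packingRadius X).toReal) := by
    rw [packingCoveringRatio, div_lt_iff₀ hr] at hk
    linarith
  refine ⟨2 * (packingRadius X).toReal, by positivity, ?_, ?_⟩
  · have hcount : patchCount X (2 * (packingRadius X).toReal) = 1 := by
      rw [patchCount, Set.encard_eq_one]
      refine ⟨X, ?_⟩
      rw [Set.image_congr (fun x hx => hX.patchClass_eq hx)]
      exact hX.nonempty.image_const X
    rw [hcount, ENat.toENNReal_one, ← ENNReal.ofReal_one]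
    refine (ENNReal.ofReal_lt_ofReal_iff_of_nonneg zero_le_one).2 ?_
    rwa [← mul_div_assoc, one_lt_div hR]
  · obtain ⟨M, hM1, hM2⟩ := exists_between hk'
    refine lt_of_le_of_lt (sInf_le (a := ENNReal.ofReal M) ?_)
      ((ENNReal.ofReal_lt_ofReal_iff_of_nonneg (hR.le.trans hM1.le)).2 hM2)
    intro c x hx
    rw [hX.patchClass_eq hx]
    obtain ⟨y, hy, hcy⟩ := hX.exists_dist_lt hM1 c
    refine ⟨y, hy, ?_⟩
    rw [edist_dist, dist_comm]
    exact ENNReal.ofReal_le_ofReal hcy.le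

theorem IsDelone.exists_isAperiodic (hX : IsDelone X) {k : ℝ} (hk : packingCoveringRatio X < k) :
    ∃ Y : Set E, IsDelone Y ∧ packingCoveringRatio Y < k ∧ IsAperiodic Y := by
  classical
  by_cases hap : IsAperiodic X
  · exact ⟨X, hX, hk, hap⟩
  obtain ⟨η, hη, hf⟩ := hX.exists_perturbation hk
  obtain ⟨x, hx⟩ := hX.nonempty
  have hr := hX.packingRadius_toReal_pos
  -- Length at most `η` keeps the ratio below `k`; a positive length at most `r`, hence below `2r`,
  -- keeps `x + v` outside `X`.
  obtain ⟨v, hv⟩ := exists_norm_eq E (le_min hη.le hr.le)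
  have hvd : dist (x + v) x = min η (packingRadius X).toReal := by
    rw [dist_eq_norm, add_sub_cancel_left, hv]
  have hx' : x + v ∉ X := by
    intro hmem
    have hne : x + v ≠ x := by
      rw [← dist_pos, hvd]
      exact lt_min hη hr
    have h1 := two_mul_packingRadius_toReal_le_dist hmem hx hne
    have h2 := min_le_right η (packingRadius X).toReal
    linarith
  obtain ⟨h1, h2⟩ := hf (Function.update id x (x + v)) (by
    intro y _
    by_cases hyx : y = x
    · subst hyx
      rw [Function.update_self, hvd]
      exact min_le_left _ _
    · simp [hyx, hη.le])
  exact ⟨_, h1, h2, isAperiodic_update_image hap hx hx'⟩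

end PackingCovering

/-! ### Lattices as integer spans of bases. -/

section LatticeBasis

variable {E : Type*} [NormedAddCommGroup E] [NormedSpace ℝ E]

theorem IsLattice.exists_basis [FiniteDimensional ℝ E] {L : Submodule ℤ E} (hL : IsLattice L) :
    ∃ b : Module.Basis (Fin (Module.finrank ℝ E)) ℝ E, Submodule.span ℤ (Set.range b) = L := by
  obtain ⟨h1, h2⟩ := hL
  have : Module.Finite ℤ L := ZLattice.module_finite ℝ L
  have : Module.Free ℤ L := ZLattice.module_free ℝ L
  let b := (Module.finBasisOfFinrankEq ℤ L (ZLattice.rank ℝ L)).ofZLatticeBasis ℝ L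
  exact ⟨b, Module.Basis.ofZLatticeBasis_span ..⟩

variable {ι : Type*} [Fintype ι] (b : Module.Basis ι ℝ E)

theorem isLattice_span_range : IsLattice (Submodule.span ℤ (Set.range b)) :=
  ⟨inferInstance, inferInstance⟩

theorem exists_mem_span_dist_le :
    ∃ D : ℝ, 0 ≤ D ∧ ∀ c : E, ∃ v ∈ Submodule.span ℤ (Set.range b),
      c - v ∈ ZSpan.fundamentalDomain b ∧ dist c v ≤ D := by
  refine ⟨∑ i, ‖b i‖, by positivity, fun c => ⟨ZSpan.floor b c, (ZSpan.floor b c).2,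
    ZSpan.fract_mem_fundamentalDomain b c, ?_⟩⟩
  rw [dist_eq_norm]
  exact ZSpan.norm_fract_le b c

theorem finite_span_inter_ball (c : E) (r : ℝ) :
    ((Submodule.span ℤ (Set.range b) : Set E) ∩ Metric.ball c r).Finite := by
  have : FiniteDimensional ℝ E := b.finiteDimensional_of_finite
  have : ProperSpace E := FiniteDimensional.proper_real E
  rw [Set.inter_comm]
  exact ZSpan.setFinite_inter b Metric.isBounded_ball

omit [NormedSpace ℝ E] in
theorem exists_pos_le_norm_of_finite {K : Set E} (hK : K.Finite) (h0 : ∀ v ∈ K, v ≠ 0) :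
    ∃ ρ > 0, ∀ v ∈ K, ρ ≤ ‖v‖ := by
  rcases K.eq_empty_or_nonempty with rfl | hne
  · exact ⟨1, one_pos, by simp⟩
  · obtain ⟨v, hv, hmin⟩ := K.exists_min_image (‖·‖) hK hne
    exact ⟨‖v‖, norm_pos_iff.2 (h0 v hv), hmin⟩

theorem isDelone_span_range : IsDelone (Submodule.span ℤ (Set.range b) : Set E) := by
  obtain ⟨D, -, hD⟩ := exists_mem_span_dist_le b
  obtain ⟨ρ, hρ, hmin⟩ := exists_pos_le_norm_of_finite
    (K := ((Submodule.span ℤ (Set.range b) : Set E) ∩ Metric.ball 0 1) \ {0})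
    ((finite_span_inter_ball b 0 1).subset Set.sdiff_subset) (fun v hv => hv.2)
  refine isDelone_of_dist (r := min ρ 1 / 2) (R := D) (by positivity) ?_
    (fun c => (hD c).imp fun v hv => ⟨hv.1, hv.2.2⟩)
  intro x hx y hy hxy
  rw [mul_div_cancel₀ _ two_ne_zero, dist_eq_norm]
  by_cases h1 : ‖x - y‖ < 1
  · exact (min_le_left _ _).trans
      (hmin _ ⟨⟨Submodule.sub_mem _ hx hy, by simpa using h1⟩, sub_ne_zero.2 hxy⟩)
  · exact (min_le_right _ _).trans (not_lt.1 h1)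

theorem IsLattice.isDelone [FiniteDimensional ℝ E] {L : Submodule ℤ E} (hL : IsLattice L) :
    IsDelone (L : Set E) := by
  obtain ⟨b, rfl⟩ := hL.exists_basis
  exact isDelone_span_range b

end LatticeBasis

/-! ### Reals independent of `1` over the integers. -/

section Irrational

theorem exists_rationally_independent_reals (ι : Type*) [Fintype ι] :
    ∃ α : ι → ℝ, ∀ (c : ι → ℤ) (m : ℤ), ∑ i, c i * α i = m → c = 0 := by
  let e := Fintype.equivFin ι
  -- Positive powers of a transcendental number serve: an integer relation is a polynomial vanishing
  -- at `τ`. Exponents start at 1 so that the constant term is left for `m`.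
  set τ : ℝ := liouvilleNumber (2 : ℕ)
  have hτ : Transcendental ℤ τ := transcendental_liouvilleNumber le_rfl
  refine ⟨fun i => τ ^ ((e i : ℕ) + 1), fun c m h => ?_⟩
  set p : Polynomial ℤ := ∑ i, Polynomial.monomial ((e i : ℕ) + 1) (c i) - Polynomial.C m with hp
  have hp0 : p = 0 := by
    by_contra hne
    refine hτ ⟨p, hne, ?_⟩
    simp [hp, Polynomial.aeval_monomial, h]
  funext i
  have hcoeff := congrArg (fun q => Polynomial.coeff q ((e i : ℕ) + 1)) hp0
  rw [hp, Polynomial.coeff_sub, Polynomial.finsetSum_coeff, Polynomial.coeff_C_of_ne_zero (by simp),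
    sub_zero, Finset.sum_eq_single_of_mem i (Finset.mem_univ i)] at hcoeff
  · simpa using hcoeff
  · intro j _ hji
    rw [Polynomial.coeff_monomial_of_ne]
    simpa [Fin.val_inj] using hji.symm

end Irrational

/-! ### Generic `φ` and arbitrarily small `δ`. -/

section PerturbationData

variable {E : Type*} [NormedAddCommGroup E] [NormedSpace ℝ E]

/-- The functional `φ` takes no integer values at the nonzero vectors of `L`, and the vectors
`v + (φ v + m) δ` with `v ∈ L` and `m ∈ ℤ` vanish only for `v = 0` and `m = 0`. -/
structure IsGeneric (L : Submodule ℤ E) (φ : E →ₗ[ℝ] ℝ) (δ : E) : Prop where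
  eq_zero_of_eq_intCast : ∀ v ∈ L, ∀ m : ℤ, φ v = m → v = 0
  eq_zero_of_add_smul : ∀ v ∈ L, ∀ m : ℤ, v + (φ v + m) • δ = 0 → v = 0 ∧ m = 0

theorem exists_isGeneric {ι : Type*} [Fintype ι] [Nonempty ι] (b : Module.Basis ι ℝ E) {η : ℝ}
    (hη : 0 < η) : ∃ (φ : E →ₗ[ℝ] ℝ) (δ : E),
      ‖δ‖ ≤ η ∧ IsGeneric (Submodule.span ℤ (Set.range b)) φ δ := by
  classical
  obtain ⟨α, hα⟩ := exists_rationally_independent_reals ι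
  obtain ⟨i⟩ := ‹Nonempty ι›
  obtain ⟨N, hN⟩ := exists_nat_gt (‖b i‖ / η)
  have hN0 : (0 : ℝ) < N := (by positivity : 0 ≤ ‖b i‖ / η).trans_lt hN
  set φ : E →ₗ[ℝ] ℝ := b.constr ℝ α with hφ
  have hφv : ∀ v ∈ Submodule.span ℤ (Set.range b), ∀ m : ℤ, φ v = m → v = 0 := by
    intro v hv m hm
    rw [b.mem_span_iff_repr_mem ℤ] at hv
    choose c hc using hv
    have hc' : ∀ i, b.repr v i = c i := fun i => by simpa using (hc i).symm
    have hc0 : c = 0 := by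
      refine hα c m ?_
      rw [← hm, hφ, Module.Basis.constr_apply_fintype]
      simp [hc']
    refine b.repr.map_eq_zero_iff.1 (Finsupp.ext fun i => ?_)
    simp [hc', hc0]
  -- With `δ` a fraction `1 / N` of a basis vector, the `i`-th coordinate of `v + (φ v + m) δ = 0`
  -- forces `φ v` to be an integer, hence `v = 0`.
  refine ⟨φ, (N : ℝ)⁻¹ • b i, ?_, hφv, ?_⟩
  · rw [norm_smul, norm_inv, RCLike.norm_natCast, inv_mul_le_iff₀ hN0]
    rw [div_lt_iff₀ hη] at hN
    exact hN.le
  · intro v hv m hm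
    have hc : ∃ c : ℤ, b.repr v i = c := by
      have := (b.mem_span_iff_repr_mem ℤ v).1 hv i
      obtain ⟨c, hc⟩ := this
      exact ⟨c, by simpa using hc.symm⟩
    obtain ⟨c, hc⟩ := hc
    have hcoord : (c : ℝ) + (φ v + m) * (N : ℝ)⁻¹ = 0 := by
      have := congrArg (fun w => b.repr w i) hm
      simpa [hc] using this
    have hφ' : φ v = ((-(N * c) - m : ℤ) : ℝ) := by
      field_simp at hcoord
      push_cast
      linarith
    have hv0 := hφv v hv _ hφ'
    refine ⟨hv0, ?_⟩
    rw [hv0] at hc hcoord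
    have hc0 : (c : ℝ) = 0 := by simpa using hc.symm
    rw [hc0] at hcoord
    simpa [hN0.ne'] using hcoord

end PerturbationData

/-! ### Perturbed lattices: aperiodicity, cut-and-project form, Meyer property. -/

section Perturbation

variable {E : Type*} [NormedAddCommGroup E] [NormedSpace ℝ E]

/-- The displacement `v ↦ v + ⟨φ v⟩ δ` that defines a perturbed lattice. -/
noncomputable def perturb (φ : E →ₗ[ℝ] ℝ) (δ v : E) : E := v + Int.fract (φ v) • δ

variable {L : Submodule ℤ E} {φ : E →ₗ[ℝ] ℝ} {δ : E}

@[simp]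
theorem perturb_zero : perturb φ δ 0 = 0 := by simp [perturb]

theorem norm_fract_smul_le (t : ℝ) : ‖Int.fract t • δ‖ ≤ ‖δ‖ := by
  rw [norm_smul, Real.norm_of_nonneg (Int.fract_nonneg t)]
  exact mul_le_of_le_one_left (norm_nonneg δ) (Int.fract_lt_one t).le

theorem dist_perturb_le (v : E) : dist (perturb φ δ v) v ≤ ‖δ‖ := by
  rw [dist_eq_norm, perturb, add_sub_cancel_left]
  exact norm_fract_smul_le _

theorem fract_add_eq_ite (u v : E) : Int.fract (φ (u + v)) =
    Int.fract (φ u) + Int.fract (φ v) - if Int.fract (φ u) < 1 - Int.fract (φ v) then 0 else 1 := by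
  have hu0 := Int.fract_nonneg (φ u)
  have hu1 := Int.fract_lt_one (φ u)
  have hv0 := Int.fract_nonneg (φ v)
  have hv1 := Int.fract_lt_one (φ v)
  rw [map_add, Int.fract_eq_iff]
  split_ifs with h
  · refine ⟨by linarith, by linarith, ⌊φ u⌋ + ⌊φ v⌋, ?_⟩
    push_cast
    rw [← Int.self_sub_floor, ← Int.self_sub_floor]
    ring
  · refine ⟨by linarith, by linarith, ⌊φ u⌋ + ⌊φ v⌋ + 1, ?_⟩
    push_cast
    rw [← Int.self_sub_floor, ← Int.self_sub_floor]
    ring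

theorem perturb_add_sub_perturb (u v : E) : perturb φ δ (u + v) - perturb φ δ u =
    v + (Int.fract (φ v) - if Int.fract (φ u) < 1 - Int.fract (φ v) then 0 else 1) • δ := by
  rw [perturb, perturb, fract_add_eq_ite]
  module

/-- Since `⟨φ v⟩ - k` differs from `φ v` by an integer, subtracting the two sides gives a relation
of the form excluded by genericity. -/
theorem IsGeneric.of_add_fract_smul_eq (h : IsGeneric L φ δ) {v w : E} (hv : v ∈ L) (hw : w ∈ L)
    {k l : ℤ} (he : v + (Int.fract (φ v) - k) • δ = w + (Int.fract (φ w) - l) • δ) :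
    v = w ∧ k = l := by
  have h0 := h.eq_zero_of_add_smul (v - w) (sub_mem hv hw) (⌊φ w⌋ - ⌊φ v⌋ - k + l) (by
    rw [← sub_eq_zero] at he
    rw [← he, ← Int.self_sub_floor, ← Int.self_sub_floor]
    push_cast
    rw [map_sub]
    module)
  have hvw := sub_eq_zero.1 h0.1
  refine ⟨hvw, ?_⟩
  have h2 := h0.2
  rw [hvw] at h2
  omega

theorem IsGeneric.injOn_perturb (h : IsGeneric L φ δ) : Set.InjOn (perturb φ δ) L := by
  intro v hv w hw hvw
  refine (h.of_add_fract_smul_eq hv hw (k := 0) (l := 0) ?_).1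
  simpa [perturb] using hvw

theorem IsGeneric.of_perturb_sub_eq (h : IsGeneric L φ δ) {u v x y : E} (hx : x ∈ L) (hy : y ∈ L)
    (he : perturb φ δ (u + x) - perturb φ δ u = perturb φ δ (v + y) - perturb φ δ v) :
    x = y ∧ (Int.fract (φ u) < 1 - Int.fract (φ x) ↔ Int.fract (φ v) < 1 - Int.fract (φ x)) := by
  rw [perturb_add_sub_perturb, perturb_add_sub_perturb] at he
  obtain ⟨h1, h2⟩ := h.of_add_fract_smul_eq hx hy
    (k := if Int.fract (φ u) < 1 - Int.fract (φ x) then 0 else 1)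
    (l := if Int.fract (φ v) < 1 - Int.fract (φ y) then 0 else 1) (by push_cast; exact he)
  refine ⟨h1, ?_⟩
  subst h1
  split_ifs at h2 with h3 h4 h4 <;> simp_all only [zero_ne_one, one_ne_zero]

/-- As `0` belongs to the set, a period `t` is the point at some `v`. The point at `-v` moved by `t`
is the point at some `w`; comparing this displacement with the one from `0` to `t` gives `w = 0`.
Hence `⟨φ (-v)⟩ + ⟨φ v⟩ = 0`, so `φ v` is an integer and `v = 0`. -/
theorem IsGeneric.isAperiodic (h : IsGeneric L φ δ) : IsAperiodic (perturb φ δ '' (L : Set E)) := by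
  intro t ht
  have hmem : ∀ x ∈ perturb φ δ '' (L : Set E), x + t ∈ perturb φ δ '' (L : Set E) :=
    fun x hx => ht ▸ Set.mem_image_of_mem (· + t) hx
  obtain ⟨v, hv, hvt⟩ : ∃ v ∈ L, perturb φ δ v = t := by
    simpa using hmem 0 ⟨0, zero_mem L, perturb_zero⟩
  obtain ⟨w, hw, hwt⟩ := hmem _ ⟨-v, neg_mem hv, rfl⟩
  have hvw := h.of_perturb_sub_eq (u := -v) (v := 0) (x := v + w) (y := v) (add_mem hv hw) hv (by
    rw [neg_add_cancel_left, hwt, zero_add, perturb_zero, sub_zero, add_sub_cancel_left, hvt])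
  have hw0 : w = 0 := add_eq_left.1 hvw.1
  rw [hw0, perturb_zero, ← hvt, perturb, perturb, neg_add_eq_sub, ← sub_eq_zero] at hwt
  have hsum : (Int.fract (φ (-v)) + Int.fract (φ v)) • δ = 0 := by
    rw [← neg_eq_zero, ← hwt]
    module
  have hδ : δ ≠ 0 := by
    rintro rfl
    have := (h.eq_zero_of_add_smul 0 (zero_mem L) 1 (by simp)).2
    omega
  have hs := (smul_eq_zero.1 hsum).resolve_right hδ
  have h1 := Int.fract_nonneg (φ (-v))
  have h2 := Int.fract_nonneg (φ v)
  obtain ⟨m, hm⟩ := Int.fract_eq_zero_iff.1 (show Int.fract (φ v) = 0 by linarith)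
  rw [← hvt, h.eq_zero_of_eq_intCast v hv m hm.symm, perturb_zero]

theorem isPerturbedLattice_image_perturb (hL : IsLattice L) :
    IsPerturbedLattice (perturb φ δ '' (L : Set E)) :=
  ⟨L, hL, φ, δ, rfl⟩

/-- The shear of `E × ℝ` that maps `L × ℤ` to the lattice which defines the perturbed lattice as a
cut-and-project set. -/
noncomputable def shear (φ : E →ₗ[ℝ] ℝ) (δ : E) : (E × ℝ) ≃ₗ[ℝ] (E × ℝ) where
  toFun p := (p.1 + (φ p.1 + p.2) • δ, φ p.1 + p.2)
  invFun p := (p.1 - p.2 • δ, p.2 - φ (p.1 - p.2 • δ))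
  map_add' p q := by
    ext
    · simp only [Prod.fst_add, Prod.snd_add, map_add]
      module
    · simp only [Prod.fst_add, Prod.snd_add, map_add]
      ring
  map_smul' c p := by
    ext
    · simp only [Prod.smul_fst, Prod.smul_snd, map_smul, RingHom.id_apply, smul_eq_mul]
      module
    · simp only [Prod.smul_fst, Prod.smul_snd, map_smul, RingHom.id_apply, smul_eq_mul]
      ring
  left_inv p := by simp
  right_inv p := by simp

variable {ι : Type*} [Fintype ι] (b : Module.Basis ι ℝ E)

omit [Fintype ι] in
theorem mem_span_shear_iff {l : E × ℝ} :
    l ∈ Submodule.span ℤ (Set.range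
      ((b.prod (Module.Basis.singleton Unit ℝ)).map (shear φ δ))) ↔
    ∃ v ∈ Submodule.span ℤ (Set.range b), ∃ m : ℤ, l = (v + (φ v + m) • δ, φ v + m) := by
  rw [Module.Basis.mem_span_iff_repr_mem]
  have hrepr : ∀ i, ((b.prod (Module.Basis.singleton Unit ℝ)).map (shear φ δ)).repr l i =
      (b.prod (Module.Basis.singleton Unit ℝ)).repr ((shear φ δ).symm l) i := fun i => rfl
  simp only [hrepr, Sum.forall, Module.Basis.prod_repr_inl, Module.Basis.prod_repr_inr,
    ← b.mem_span_iff_repr_mem ℤ]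
  constructor
  · rintro ⟨h1, h2⟩
    obtain ⟨m, hm⟩ := h2 ()
    have hm' : (m : ℝ) = ((shear φ δ).symm l).2 := by simpa using hm
    refine ⟨_, h1, m, ?_⟩
    rw [hm']
    exact ((shear φ δ).apply_symm_apply l).symm
  · rintro ⟨v, hv, m, rfl⟩
    have hs : (shear φ δ).symm (v + (φ v + m) • δ, φ v + m) = (v, (m : ℝ)) :=
      (shear φ δ).symm_apply_apply (v, (m : ℝ))
    rw [hs]
    exact ⟨hv, fun _ => ⟨m, by simp⟩⟩

theorem IsGeneric.irrational (h : IsGeneric L φ δ) {v : E} (hv : v ∈ L) (hv0 : v ≠ 0) :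
    Irrational (φ v) := by
  rintro ⟨q, hq⟩
  have h1 := h.eq_zero_of_eq_intCast ((q.den : ℤ) • v) (L.smul_mem _ hv) q.num (by
    rw [← Int.cast_smul_eq_zsmul ℝ, map_smul, ← hq, smul_eq_mul, Int.cast_natCast]
    exact_mod_cast Rat.den_mul_eq_num q)
  rw [← Int.cast_smul_eq_zsmul ℝ, smul_eq_zero] at h1
  rcases h1 with h1 | h1
  · exact q.den_nz (by exact_mod_cast h1)
  · exact hv0 h1

theorem IsGeneric.isCutAndProject [Nonempty ι]
    (h : IsGeneric (Submodule.span ℤ (Set.range b)) φ δ) :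
    IsCutAndProject (perturb φ δ '' (Submodule.span ℤ (Set.range b) : Set E)) := by
  refine ⟨Submodule.span ℤ (Set.range ((b.prod (Module.Basis.singleton Unit ℝ)).map (shear φ δ))),
    isLattice_span_range _, ?_, ?_, 0, 1, one_pos, ?_⟩
  · intro l hl l' hl' he
    obtain ⟨v, hv, m, rfl⟩ := (mem_span_shear_iff b).1 hl
    obtain ⟨v', hv', m', rfl⟩ := (mem_span_shear_iff b).1 hl'
    have h0 := h.eq_zero_of_add_smul (v - v') (sub_mem hv hv') (m - m') (by
      rw [← sub_eq_zero.2 he, map_sub]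
      push_cast
      module)
    rw [sub_eq_zero.1 h0.1, sub_eq_zero.1 h0.2]
  · obtain ⟨i⟩ := ‹Nonempty ι›
    have hbi : b i ∈ Submodule.span ℤ (Set.range b) := Submodule.subset_span ⟨i, rfl⟩
    -- A single lattice direction suffices: `1` and the irrational `φ (b i)` generate a dense
    -- subgroup.
    refine (dense_addSubgroupClosure_pair_iff (a := (1 : ℝ)).2
      (by simpa using h.irrational hbi (b.ne_zero i))).mono ?_
    intro s hs
    obtain ⟨p, q, hpq⟩ := AddSubgroup.mem_closure_pair.1 hs
    refine ⟨_, (mem_span_shear_iff b).2 ⟨q • b i, Submodule.smul_mem _ q hbi, p, rfl⟩, ?_⟩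
    rw [← hpq, ← Int.cast_smul_eq_zsmul ℝ q (b i), map_smul]
    simp [add_comm]
  · ext x
    simp only [Set.mem_image, Set.mem_ofPred_eq, mem_span_shear_iff]
    constructor
    · rintro ⟨v, hv, rfl⟩
      refine ⟨(v + Int.fract (φ v) • δ, Int.fract (φ v)), ⟨⟨v, hv, -⌊φ v⌋, ?_⟩,
        Int.fract_nonneg _, Int.fract_lt_one _⟩, rfl⟩
      rw [← Int.self_sub_floor]
      push_cast
      rfl
    -- The window `[0, 1)` forces `m = -⌊φ v⌋`, so each `v` contributes exactly one point.
    · rintro ⟨_, ⟨⟨v, hv, m, rfl⟩, h0, h1⟩, rfl⟩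
      refine ⟨v, hv, ?_⟩
      have : Int.fract (φ v) = φ v + m := Int.fract_eq_iff.2 ⟨h0, h1, -m, by push_cast; ring⟩
      rw [perturb, this]

omit [Fintype ι] in
theorem finite_setOf_abs_add_intCast_le (s B : ℝ) : {m : ℤ | |s + m| ≤ B}.Finite := by
  refine (Set.finite_Icc ⌊-B - s⌋ ⌈B - s⌉).subset fun m hm => ?_
  obtain ⟨h1, h2⟩ := abs_le.1 (show |s + m| ≤ B from hm)
  constructor
  · exact_mod_cast (Int.floor_le _).trans (by linarith : -B - s ≤ m)
  · exact_mod_cast (by linarith : (m : ℝ) ≤ B - s).trans (Int.le_ceil _)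

/-- A difference of two differences has the form `v + s δ` with `v ∈ L`, `s ∈ φ v + ℤ` and `|s| ≤
2`. If it is shorter than 1 then `‖v‖ < 1 + 2‖δ‖`, which leaves finitely many vectors. Covering is
inherited because `0` is in the set, so the differences include the set. -/
theorem isMeyer_image_perturb
    (hZ : IsDelone (perturb φ δ '' (Submodule.span ℤ (Set.range b) : Set E))) :
    IsMeyer (perturb φ δ '' (Submodule.span ℤ (Set.range b) : Set E)) := by
  set L := Submodule.span ℤ (Set.range b) with hL
  let K : Set E := (⋃ v ∈ (L : Set E) ∩ Metric.ball 0 (1 + 2 * ‖δ‖),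
    (fun m : ℤ => v + (φ v + m) • δ) '' {m : ℤ | |φ v + m| ≤ 2}) \ {0}
  have hK : K.Finite := by
    refine Set.Finite.subset ?_ Set.sdiff_subset
    refine (finite_span_inter_ball b 0 _).biUnion fun v _ => Set.Finite.image _ ?_
    exact finite_setOf_abs_add_intCast_le _ _
  obtain ⟨ρ, hρ, hmin⟩ := exists_pos_le_norm_of_finite hK (fun v hv => hv.2)
  refine ⟨hZ, isDelone_of_dist (r := min ρ 1 / 2)
    (R := (coveringRadius (perturb φ δ '' (L : Set E))).toReal + 1)
    (by positivity) ?_ fun c => ?_⟩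
  · rintro _ ⟨_, ⟨v₁, hv₁, rfl⟩, _, ⟨v₂, hv₂, rfl⟩, rfl⟩ _
      ⟨_, ⟨v₃, hv₃, rfl⟩, _, ⟨v₄, hv₄, rfl⟩, rfl⟩ hne
    rw [mul_div_cancel₀ _ two_ne_zero, dist_eq_norm]
    set d := perturb φ δ v₁ - perturb φ δ v₂ - (perturb φ δ v₃ - perturb φ δ v₄) with hd
    by_cases h1 : ‖d‖ < 1
    swap
    · exact (min_le_right _ _).trans (not_lt.1 h1)
    refine (min_le_left _ _).trans (hmin _ ?_)
    set v := v₁ - v₂ - (v₃ - v₄) with hv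
    set s := Int.fract (φ v₁) - Int.fract (φ v₂) - (Int.fract (φ v₃) - Int.fract (φ v₄)) with hs
    have hdv : d = v + s • δ := by
      rw [hd, hv, hs]
      simp only [perturb]
      module
    have hs2 : |s| ≤ 2 := by
      have h := fun w => And.intro (Int.fract_nonneg (φ w)) (Int.fract_lt_one (φ w))
      have := h v₁
      have := h v₂
      have := h v₃
      have := h v₄
      rw [abs_le]
      constructor <;> linarith
    obtain ⟨m, hsm⟩ : ∃ m : ℤ, s = φ v + m := by
      refine ⟨-(⌊φ v₁⌋ - ⌊φ v₂⌋ - (⌊φ v₃⌋ - ⌊φ v₄⌋)), ?_⟩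
      rw [hs, hv]
      simp only [← Int.self_sub_floor, map_sub]
      push_cast
      ring
    refine ⟨Set.mem_biUnion (x := v) ⟨?_, ?_⟩ ⟨m, ?_, ?_⟩, sub_ne_zero.2 hne⟩
    · exact sub_mem (sub_mem hv₁ hv₂) (sub_mem hv₃ hv₄)
    · rw [mem_ball_zero_iff]
      have h2 : v = d - s • δ := by rw [hdv, add_sub_cancel_right]
      have h3 : ‖s • δ‖ ≤ 2 * ‖δ‖ := by
        rw [norm_smul, Real.norm_eq_abs]
        gcongr
      rw [h2]
      exact (norm_sub_le _ _).trans_lt (by linarith)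
    · rw [Set.mem_ofPred_eq, ← hsm]
      exact hs2
    · rw [hdv, hsm]
  · obtain ⟨y, hy, hcy⟩ := hZ.exists_dist_lt (lt_add_one _) c
    exact ⟨y, ⟨y, hy, 0, ⟨0, zero_mem L, perturb_zero⟩, (sub_zero y).symm⟩, hcy.le⟩

end Perturbation

/-! ### Patch classes as intervals of values of `⟨φ v⟩`. -/

section PatchClasses

variable {E : Type*} [NormedAddCommGroup E] [NormedSpace ℝ E]
variable {L : Submodule ℤ E} {φ : E →ₗ[ℝ] ℝ} {δ : E}

omit [NormedSpace ℝ E] in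
theorem PatchEquiv.symm {X : Set E} {T : ℝ} {x y : E} (h : PatchEquiv X T x y) :
    PatchEquiv X T y x := by
  unfold PatchEquiv at h ⊢
  rw [h, Set.image_image]
  simp only [add_assoc, sub_add_sub_cancel, sub_self, add_zero, Set.image_id']

/-- The lattice vectors that can occur as displacements inside `T`-patches. -/
def patchVectors (L : Submodule ℤ E) (φ : E →ₗ[ℝ] ℝ) (δ : E) (T : ℝ) : Set E :=
  {v ∈ (L : Set E) | ‖v + Int.fract (φ v) • δ‖ < T ∨ ‖v + (Int.fract (φ v) - 1) • δ‖ < T}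

/-- The points at `u` and at `v` are on the same side of all thresholds given by the vectors that
can occur inside `T`-patches. -/
def SameSide (L : Submodule ℤ E) (φ : E →ₗ[ℝ] ℝ) (δ : E) (T : ℝ) (u v : E) : Prop :=
  ∀ w ∈ patchVectors L φ δ T,
    Int.fract (φ u) < 1 - Int.fract (φ w) ↔ Int.fract (φ v) < 1 - Int.fract (φ w)

theorem mem_patchVectors_of_dist_lt {T : ℝ} {u v : E} (hv : v ∈ L)
    (h : dist (perturb φ δ (u + v)) (perturb φ δ u) < T) : v ∈ patchVectors L φ δ T := by
  rw [dist_eq_norm, perturb_add_sub_perturb] at h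
  refine ⟨hv, ?_⟩
  split_ifs at h
  · exact Or.inl (by simpa using h)
  · exact Or.inr h

theorem exists_eq_perturb_add {T : ℝ} {u z : E} (hu : u ∈ L)
    (hz : z ∈ patch (perturb φ δ '' (L : Set E)) T (perturb φ δ u)) :
    ∃ v ∈ patchVectors L φ δ T, z = perturb φ δ (u + v) := by
  obtain ⟨⟨w, hw, rfl⟩, hd⟩ := hz
  refine ⟨w - u, mem_patchVectors_of_dist_lt (u := u) (sub_mem hw hu) ?_, ?_⟩ <;> rw [add_sub_cancel]
  exact hd

theorem SameSide.symm {T : ℝ} {u v : E} (h : SameSide L φ δ T u v) : SameSide L φ δ T v u :=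
  fun w hw => (h w hw).symm

theorem SameSide.perturb_sub_eq {T : ℝ} {u v w : E} (h : SameSide L φ δ T u v)
    (hw : w ∈ patchVectors L φ δ T) :
    perturb φ δ (u + w) - perturb φ δ u = perturb φ δ (v + w) - perturb φ δ v := by
  rw [perturb_add_sub_perturb, perturb_add_sub_perturb]
  simp only [h w hw]

theorem SameSide.add_mem_patch {T : ℝ} {u v z : E} (h : SameSide L φ δ T u v) (hu : u ∈ L)
    (hv : v ∈ L) (hz : z ∈ patch (perturb φ δ '' (L : Set E)) T (perturb φ δ u)) :
    z + (perturb φ δ v - perturb φ δ u) ∈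
      patch (perturb φ δ '' (L : Set E)) T (perturb φ δ v) := by
  obtain ⟨w, hw, rfl⟩ := exists_eq_perturb_add hu hz
  have heq := h.perturb_sub_eq hw
  have h1 : perturb φ δ (u + w) + (perturb φ δ v - perturb φ δ u) = perturb φ δ (v + w) := by
    rw [sub_eq_sub_iff_add_eq_add] at heq
    rw [← add_sub_assoc, heq, add_sub_cancel_right]
  rw [h1]
  refine ⟨⟨_, add_mem hv hw.1, rfl⟩, ?_⟩
  have h2 := hz.2
  rw [Metric.mem_ball, dist_eq_norm] at h2 ⊢
  rwa [← heq]

theorem SameSide.patchEquiv {T : ℝ} {u v : E} (h : SameSide L φ δ T u v) (hu : u ∈ L)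
    (hv : v ∈ L) :
    PatchEquiv (perturb φ δ '' (L : Set E)) T (perturb φ δ u) (perturb φ δ v) := by
  ext z
  constructor
  · intro hz
    refine ⟨_, h.symm.add_mem_patch hv hu hz, ?_⟩
    dsimp only
    abel
  · rintro ⟨y, hy, rfl⟩
    exact h.add_mem_patch hu hv hy

theorem IsGeneric.side_iff_of_patchEquiv (hg : IsGeneric L φ δ) {T : ℝ} {u v w : E} (hu : u ∈ L)
    (hv : v ∈ L) (hw : w ∈ L)
    (h : PatchEquiv (perturb φ δ '' (L : Set E)) T (perturb φ δ u) (perturb φ δ v))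
    (hd : dist (perturb φ δ (u + w)) (perturb φ δ u) < T) :
    Int.fract (φ u) < 1 - Int.fract (φ w) ↔ Int.fract (φ v) < 1 - Int.fract (φ w) := by
  have hmem : perturb φ δ (u + w) + (perturb φ δ v - perturb φ δ u) ∈
      patch (perturb φ δ '' (L : Set E)) T (perturb φ δ v) := by
    rw [h]
    exact ⟨_, ⟨⟨_, add_mem hu hw, rfl⟩, hd⟩, rfl⟩
  obtain ⟨x, hx, hxe⟩ := exists_eq_perturb_add hv hmem
  refine (hg.of_perturb_sub_eq hw hx.1 ?_).2
  rw [← hxe]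
  abel

/-- If `w` separates `u` from `v`, their displacements along `w` are the two candidates in
`patchVectors`, one of which is shorter than `T`. It is visible in one patch and, by genericity,
cannot occur in the other. -/
theorem IsGeneric.patchEquiv_iff (hg : IsGeneric L φ δ) {T : ℝ} {u v : E} (hu : u ∈ L)
    (hv : v ∈ L) :
    PatchEquiv (perturb φ δ '' (L : Set E)) T (perturb φ δ u) (perturb φ δ v) ↔
      SameSide L φ δ T u v := by
  refine ⟨fun h w hw => ?_, fun h => h.patchEquiv hu hv⟩
  by_contra hne
  have hu' : ¬ dist (perturb φ δ (u + w)) (perturb φ δ u) < T :=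
    fun hd => hne (hg.side_iff_of_patchEquiv hu hv hw.1 h hd)
  have hv' : ¬ dist (perturb φ δ (v + w)) (perturb φ δ v) < T :=
    fun hd => hne (hg.side_iff_of_patchEquiv hv hu hw.1 h.symm hd).symm
  rw [dist_eq_norm, perturb_add_sub_perturb] at hu' hv'
  have hw2 := hw.2
  split_ifs at hu' hv' with h1 h2 h2
  · exact hne (iff_of_true h1 h2)
  · rw [sub_zero] at hu'
    tauto
  · rw [sub_zero] at hv'
    tauto
  · exact hne (iff_of_false h1 h2)

theorem IsGeneric.patchClass_eq (hg : IsGeneric L φ δ) {T : ℝ} {u : E} (hu : u ∈ L) :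
    patchClass (perturb φ δ '' (L : Set E)) T (perturb φ δ u) =
      perturb φ δ '' {v ∈ (L : Set E) | SameSide L φ δ T u v} := by
  ext y
  constructor
  · rintro ⟨⟨v, hv, rfl⟩, h⟩
    exact ⟨v, ⟨hv, (hg.patchEquiv_iff hu hv).1 h⟩, rfl⟩
  · rintro ⟨v, ⟨hv, h⟩, rfl⟩
    exact ⟨⟨v, hv, rfl⟩, (hg.patchEquiv_iff hu hv).2 h⟩

theorem zero_mem_patchVectors {T : ℝ} (hT : 0 < T) : (0 : E) ∈ patchVectors L φ δ T :=
  ⟨zero_mem L, Or.inl (by simpa using hT)⟩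

theorem patchVectors_subset (T : ℝ) :
    patchVectors L φ δ T ⊆ (L : Set E) ∩ Metric.ball 0 (T + ‖δ‖) := by
  rintro v ⟨hv, h⟩
  refine ⟨hv, ?_⟩
  rw [mem_ball_zero_iff]
  have h0 := Int.fract_nonneg (φ v)
  have h1 := Int.fract_lt_one (φ v)
  have key : ∀ s : ℝ, |s| ≤ 1 → ‖v + s • δ‖ < T → ‖v‖ < T + ‖δ‖ := by
    intro s hs hlt
    have h2 := norm_sub_le (v + s • δ) (s • δ)
    rw [add_sub_cancel_right, norm_smul, Real.norm_eq_abs] at h2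
    have h3 := mul_le_of_le_one_left (norm_nonneg δ) hs
    linarith
  rcases h with h | h
  · exact key _ (by rw [abs_of_nonneg h0]; exact h1.le) h
  · exact key _ (by rw [abs_le]; constructor <;> linarith) h

variable {ι : Type*} [Fintype ι] (b : Module.Basis ι ℝ E)

theorem finite_patchVectors (T : ℝ) :
    (patchVectors (Submodule.span ℤ (Set.range b)) φ δ T).Finite :=
  (finite_span_inter_ball b 0 _).subset (patchVectors_subset T)

theorem IsGeneric.finite_patchClass_image
    (hg : IsGeneric (Submodule.span ℤ (Set.range b)) φ δ) (T : ℝ) :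
    (patchClass (perturb φ δ '' (Submodule.span ℤ (Set.range b) : Set E)) T ''
      (perturb φ δ '' (Submodule.span ℤ (Set.range b) : Set E))).Finite := by
  set L := Submodule.span ℤ (Set.range b)
  let g : Set E → Set E := fun S => perturb φ δ '' {v ∈ (L : Set E) |
    ∀ w ∈ patchVectors L φ δ T, w ∈ S ↔ Int.fract (φ v) < 1 - Int.fract (φ w)}
  refine ((finite_patchVectors (φ := φ) (δ := δ) b T).powerset.image g).subset ?_
  rintro _ ⟨_, ⟨u, hu, rfl⟩, rfl⟩
  refine ⟨{w ∈ patchVectors L φ δ T | Int.fract (φ u) < 1 - Int.fract (φ w)},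
    Set.sep_subset _ _, ?_⟩
  rw [hg.patchClass_eq hu]
  simp only [g, SameSide]
  congr 1
  ext v
  refine and_congr_right fun _ => forall₂_congr fun w hw => ?_
  rw [Set.mem_ofPred_eq, and_iff_right hw]

/-- The numbers that bound the intervals of values of `⟨φ v⟩` which correspond to patch classes. -/
def IsThreshold (L : Submodule ℤ E) (φ : E →ₗ[ℝ] ℝ) (t : ℝ) : Prop :=
  t = 0 ∨ ∃ w ∈ L, t = 1 - Int.fract (φ w)

theorem exists_sameSide_iff {T : ℝ} (hT : 0 < T) (u : E) :
    ∃ s t : ℝ, s < t ∧ IsThreshold (Submodule.span ℤ (Set.range b)) φ s ∧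
      IsThreshold (Submodule.span ℤ (Set.range b)) φ t ∧
      ∀ v, SameSide (Submodule.span ℤ (Set.range b)) φ δ T u v ↔
        s ≤ Int.fract (φ v) ∧ Int.fract (φ v) < t := by
  classical
  set L := Submodule.span ℤ (Set.range b)
  set V := (finite_patchVectors (φ := φ) (δ := δ) b T).toFinset with hV
  set θ : E → ℝ := fun w => 1 - Int.fract (φ w) with hθ
  have hVL : ∀ w ∈ V, w ∈ L := fun w hw => ((Set.Finite.mem_toFinset _).1 hw).1
  have hSame : ∀ v, SameSide L φ δ T u v ↔
      ∀ w ∈ V, Int.fract (φ u) < θ w ↔ Int.fract (φ v) < θ w := by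
    intro v
    simp only [SameSide, hV, Set.Finite.mem_toFinset, hθ, L]
  -- The zero vector has threshold `1`, so some threshold always lies above `⟨φ u⟩`; below it there
  -- may be none, and then `0` is the lower end.
  obtain ⟨w, hw, hmin⟩ := (V.filter fun w => Int.fract (φ u) < θ w).exists_min_image θ
    ⟨0, by simpa [hV, hθ, Int.fract_lt_one] using zero_mem_patchVectors hT⟩
  rw [Finset.mem_filter] at hw
  obtain ⟨s, hs, hsu, hsv, hmax⟩ : ∃ s : ℝ, IsThreshold L φ s ∧ s ≤ Int.fract (φ u) ∧
      (∀ v, SameSide L φ δ T u v → s ≤ Int.fract (φ v)) ∧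
      ∀ v ∈ V, θ v ≤ Int.fract (φ u) → θ v ≤ s := by
    rcases (V.filter fun w => θ w ≤ Int.fract (φ u)).eq_empty_or_nonempty with hE | hE
    · refine ⟨0, Or.inl rfl, Int.fract_nonneg _, fun v _ => Int.fract_nonneg _, fun v hv hle => ?_⟩
      have : v ∈ V.filter fun w => θ w ≤ Int.fract (φ u) := Finset.mem_filter.2 ⟨hv, hle⟩
      simp [hE] at this
    · obtain ⟨x, hx, hmax⟩ := Finset.exists_max_image _ θ hE
      rw [Finset.mem_filter] at hx
      exact ⟨θ x, Or.inr ⟨x, hVL x hx.1, rfl⟩, hx.2,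
        fun v hv => not_lt.1 fun hlt => hx.2.not_gt (((hSame v).1 hv x hx.1).2 hlt),
        fun v hv hle => hmax v (Finset.mem_filter.2 ⟨hv, hle⟩)⟩
  have hsep : ∀ x ∈ V, θ x ≤ s ∨ θ w ≤ θ x := by
    intro x hx
    rcases le_or_gt (θ x) (Int.fract (φ u)) with h | h
    · exact Or.inl (hmax x hx h)
    · exact Or.inr (hmin x (Finset.mem_filter.2 ⟨hx, h⟩))
  refine ⟨s, θ w, hsu.trans_lt hw.2, hs, Or.inr ⟨w, hVL w hw.1, rfl⟩, fun v =>
    ⟨fun h => ⟨hsv v h, ((hSame v).1 h w hw.1).1 hw.2⟩, fun h => (hSame v).2 fun x hx => ?_⟩⟩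
  rcases hsep x hx with hxs | hxw
  · exact iff_of_false (hxs.trans hsu).not_gt (hxs.trans h.1).not_gt
  · exact iff_of_true (hw.2.trans_le hxw) (h.2.trans_le hxw)

end PatchClasses

/-! ### Counting lattice points in balls: frequencies and repetitivity. -/

section Counting

open MeasureTheory Filter Topology

/-- Both sums lie between those over `P` and `Q`. Used for a ball and its translate, squeezed
between concentric balls. -/
theorem abs_sum_sub_sum_le {α : Type*} {P Q A B : Finset α} {f : α → ℝ}
    (h0 : ∀ v, 0 ≤ f v) (h1 : ∀ v, f v ≤ 1)
    (hPA : P ⊆ A) (hAQ : A ⊆ Q) (hPB : P ⊆ B) (hBQ : B ⊆ Q) :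
    |∑ v ∈ A, f v - ∑ v ∈ B, f v| ≤ Q.card - P.card := by
  classical
  have hPQ : ∑ v ∈ Q, f v - ∑ v ∈ P, f v ≤ Q.card - P.card := by
    rw [← Finset.sum_sdiff (hPA.trans hAQ), add_sub_cancel_right,
      ← Finset.cast_card_sdiff (hPA.trans hAQ)]
    simpa using Finset.sum_le_card_nsmul (Q \ P) f 1 fun v _ => h1 v
  have mono : ∀ {S T : Finset α}, S ⊆ T → ∑ v ∈ S, f v ≤ ∑ v ∈ T, f v :=
    fun h => Finset.sum_le_sum_of_subset_of_nonneg h fun v _ _ => h0 v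
  have := mono hPA
  have := mono hAQ
  have := mono hPB
  have := mono hBQ
  rw [abs_le]
  constructor <;> linarith

variable {E : Type*} [NormedAddCommGroup E] [NormedSpace ℝ E] [MeasureSpace E] [BorelSpace E]
  [FiniteDimensional ℝ E] [(volume : Measure E).IsAddHaarMeasure]

/-- The volume of balls of radius `ρ`. -/
noncomputable def ballVolume (E : Type*) [NormedAddCommGroup E] [MeasureSpace E] (ρ : ℝ) : ℝ :=
  (volume : Measure E).real (Metric.ball 0 ρ)

omit [NormedSpace ℝ E] [FiniteDimensional ℝ E] in
theorem measureReal_ball (c : E) (ρ : ℝ) :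
    (volume : Measure E).real (Metric.ball c ρ) = ballVolume E ρ :=
  Measure.addHaar_real_ball_center _ c ρ

omit [BorelSpace E] in
theorem ballVolume_mono {ρ σ : ℝ} (h : ρ ≤ σ) : ballVolume E ρ ≤ ballVolume E σ :=
  measureReal_mono (Metric.ball_subset_ball h) measure_ball_lt_top.ne

omit [BorelSpace E] in
theorem ballVolume_pos {ρ : ℝ} (h : 0 < ρ) : 0 < ballVolume E ρ :=
  ENNReal.toReal_pos (Metric.measure_ball_pos _ _ h).ne' measure_ball_lt_top.ne

theorem ballVolume_eq [Nontrivial E] {ρ : ℝ} (h : 0 ≤ ρ) :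
    ballVolume E ρ = ρ ^ Module.finrank ℝ E * ballVolume E 1 := by
  rw [ballVolume, measureReal_def, Measure.addHaar_ball _ _ h, ENNReal.toReal_mul,
    ENNReal.toReal_ofReal (by positivity)]
  rfl

theorem tendsto_ballVolume_shell [Nontrivial E] (w : ℝ) :
    Tendsto (fun ρ => (ballVolume E (ρ + w) - ballVolume E (ρ - w)) / ballVolume E ρ) atTop
      (𝓝 0) := by
  have hw : Tendsto (fun ρ : ℝ => w / ρ) atTop (𝓝 0) := tendsto_const_nhds.div_atTop tendsto_id
  have h := ((hw.const_add 1).pow (Module.finrank ℝ E)).sub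
    ((hw.const_sub 1).pow (Module.finrank ℝ E))
  rw [add_zero, sub_zero, sub_self] at h
  refine h.congr' ?_
  filter_upwards [eventually_gt_atTop |w|] with ρ hρ
  have hρ0 : 0 < ρ := (abs_nonneg w).trans_lt hρ
  obtain ⟨h1, h2⟩ := abs_lt.1 hρ
  have hV := (ballVolume_pos (E := E) one_pos).ne'
  rw [ballVolume_eq (by linarith), ballVolume_eq (ρ := ρ - w) (by linarith),
    ballVolume_eq hρ0.le, ← sub_mul, mul_div_mul_right _ _ hV, sub_div, ← div_pow, ← div_pow,
    add_div, sub_div, div_self hρ0.ne']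

variable {ι : Type*} [Fintype ι] (b : Module.Basis ι ℝ E)

/-- Finite parts of a lattice that are contained in a ball, or that contain all lattice points of a
ball, compared with the volume of the ball. -/
theorem exists_card_mul_bounds : ∃ κ > 0, ∃ D ≥ 0, ∀ (A : Finset E) (c : E) (ρ : ℝ),
    ((A : Set E) ⊆ (Submodule.span ℤ (Set.range b) : Set E) ∩ Metric.ball c ρ →
      A.card * κ ≤ ballVolume E (ρ + D)) ∧
    ((Submodule.span ℤ (Set.range b) : Set E) ∩ Metric.ball c ρ ⊆ A →
      ballVolume E (ρ - D) ≤ A.card * κ) := by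
  classical
  set F := ZSpan.fundamentalDomain b with hF
  have hFm : MeasurableSet F := ZSpan.fundamentalDomain_measurableSet b
  have hFtop : volume F ≠ ⊤ := (ZSpan.fundamentalDomain_isBounded b).measure_lt_top.ne
  obtain ⟨D, hD0, hD⟩ := exists_mem_span_dist_le b
  have hFD : ∀ x ∈ F, ‖x‖ ≤ ∑ i, ‖b i‖ := by
    intro x hx
    rw [← ZSpan.fract_eq_self.2 hx]
    exact ZSpan.norm_fract_le b x
  set D' := D + ∑ i, ‖b i‖ with hD'
  have hsum : 0 ≤ ∑ i, ‖b i‖ := by positivity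
  -- These preimages are the translates `v + F`: disjoint for distinct lattice vectors and together
  -- covering the space.
  have hvol : ∀ v : E, volume ((fun x => x + -v) ⁻¹' F) = volume F :=
    fun v => measure_preimage_add_right _ _ _
  refine ⟨(volume : Measure E).real F, ENNReal.toReal_pos
    (ZSpan.measure_fundamentalDomain_ne_zero b) hFtop, D', by positivity, fun A c ρ => ⟨?_, ?_⟩⟩
  · intro hA
    have hdisj : (A : Set E).PairwiseDisjoint fun v => (fun x => x + -v) ⁻¹' F := by
      intro v hv w hw hvw
      refine Set.disjoint_left.2 fun x hxv hxw => hvw ?_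
      rw [Set.mem_preimage] at hxv hxw
      have h := (ZSpan.fract_eq_fract b (x + -v) (x + -w)).2 (by
        rw [show -(x + -v) + (x + -w) = v - w by abel]
        exact sub_mem (hA hv).1 (hA hw).1)
      rw [ZSpan.fract_eq_self.2 hxv, ZSpan.fract_eq_self.2 hxw] at h
      exact neg_injective (add_left_cancel h)
    have hsub : (⋃ v ∈ A, (fun x => x + -v) ⁻¹' F) ⊆ Metric.ball c (ρ + D') := by
      intro x hx
      simp only [Set.mem_iUnion, Set.mem_preimage] at hx
      obtain ⟨v, hv, hxv⟩ := hx
      have h1 := hFD _ hxv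
      have h2 : dist v c < ρ := (hA hv).2
      rw [← sub_eq_add_neg, ← dist_eq_norm] at h1
      have h3 := dist_triangle x v c
      rw [Metric.mem_ball]
      linarith
    have hle := measure_mono (μ := volume) hsub
    rw [measure_biUnion_finset hdisj fun v _ => hFm.preimage (measurable_add_const _)] at hle
    simp only [hvol, Finset.sum_const, nsmul_eq_mul] at hle
    have := ENNReal.toReal_mono measure_ball_lt_top.ne hle
    rw [ENNReal.toReal_mul, ENNReal.toReal_natCast] at this
    rw [← measureReal_ball c]
    exact this
  · intro hA
    have hsub : Metric.ball c (ρ - D') ⊆ ⋃ v ∈ A, (fun x => x + -v) ⁻¹' F := by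
      intro x hx
      obtain ⟨v, hv, hxv, hd⟩ := hD x
      simp only [Set.mem_iUnion, Set.mem_preimage]
      refine ⟨v, hA ⟨hv, ?_⟩, by rwa [← sub_eq_add_neg]⟩
      rw [Metric.mem_ball] at hx ⊢
      have h3 := dist_triangle v x c
      rw [dist_comm v x] at h3
      linarith
    have hle := (measure_mono (μ := volume) hsub).trans (measure_biUnion_finset_le _ _)
    simp only [hvol, Finset.sum_const, nsmul_eq_mul] at hle
    have := ENNReal.toReal_mono (ENNReal.mul_ne_top (ENNReal.natCast_ne_top _) hFtop) hle
    rw [ENNReal.toReal_mul, ENNReal.toReal_natCast] at this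
    rw [← measureReal_ball c]
    exact this

variable (φ : E →ₗ[ℝ] ℝ) (δ : E)

/-- The number of lattice vectors `v` with `⟨φ v⟩` below a threshold and displaced position in a ball:
the error term is a coboundary, so it is bounded by the number of lattice points in a shell. -/
theorem exists_abs_ncard_sub_le : ∃ κ > 0, ∀ t, IsThreshold (Submodule.span ℤ (Set.range b)) φ t →
    ∃ w ≥ 0, ∀ (c : E) (ρ : ℝ),
      |κ * ({v ∈ (Submodule.span ℤ (Set.range b) : Set E) | perturb φ δ v ∈ Metric.ball c ρ ∧
        Int.fract (φ v) < t}.ncard : ℝ) - t * ballVolume E ρ| ≤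
      2 * (ballVolume E (ρ + w) - ballVolume E (ρ - w)) := by
  classical
  obtain ⟨κ, hκ, D, hD, hbounds⟩ := exists_card_mul_bounds b
  set L := Submodule.span ℤ (Set.range b)
  refine ⟨κ, hκ, ?_⟩
  rintro t (rfl | ⟨u, hu, rfl⟩)
  · refine ⟨0, le_rfl, fun c ρ => ?_⟩
    simp [(Int.fract_nonneg _).not_gt]
  -- `‖δ‖` allows for the perturbation of positions, `‖u‖` for the translation from `A` to `B`.
  set w := ‖δ‖ + ‖u‖ with hw
  refine ⟨w + D, by positivity, fun c ρ => ?_⟩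
  have hball : ∀ (c : E) (ρ : ℝ), {v ∈ (L : Set E) | v ∈ Metric.ball c ρ}.Finite :=
    finite_span_inter_ball b
  have hQfin := hball c (ρ + w)
  have hsubQ : ∀ v, perturb φ δ v ∈ Metric.ball c ρ → dist v c < ρ + ‖δ‖ := by
    intro v hv
    have h1 := dist_perturb_le (φ := φ) (δ := δ) v
    have h2 := dist_triangle v (perturb φ δ v) c
    rw [Metric.mem_ball] at hv
    rw [dist_comm] at h1
    linarith
  have hsubP : ∀ v, dist v c < ρ - ‖δ‖ → perturb φ δ v ∈ Metric.ball c ρ := by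
    intro v hv
    have h1 := dist_perturb_le (φ := φ) (δ := δ) v
    have h2 := dist_triangle (perturb φ δ v) v c
    rw [Metric.mem_ball]
    linarith
  have hAfin : {v ∈ (L : Set E) | perturb φ δ v ∈ Metric.ball c ρ}.Finite :=
    hQfin.subset fun v hv => ⟨hv.1, by
      have := hsubQ v hv.2
      have := norm_nonneg u
      rw [Metric.mem_ball]
      linarith⟩
  set A := hAfin.toFinset with hA
  set P := (hball c (ρ - w)).toFinset with hP
  set Q := hQfin.toFinset with hQ
  set B := A.map (addRightEmbedding u) with hB
  have hnu := norm_nonneg u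
  have hPA : P ⊆ A := by
    intro v hv
    rw [hP, Set.Finite.mem_toFinset] at hv
    rw [hA, Set.Finite.mem_toFinset]
    exact ⟨hv.1, hsubP v ((Metric.mem_ball.1 hv.2).trans_le (by linarith))⟩
  have hAQ : A ⊆ Q := by
    intro v hv
    rw [hA, Set.Finite.mem_toFinset] at hv
    rw [hQ, Set.Finite.mem_toFinset]
    exact ⟨hv.1, Metric.mem_ball.2 ((hsubQ v hv.2).trans_le (by linarith))⟩
  have hPB : P ⊆ B := by
    intro v hv
    rw [hP, Set.Finite.mem_toFinset] at hv
    rw [hB, Finset.mem_map]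
    refine ⟨v - u, ?_, sub_add_cancel v u⟩
    rw [hA, Set.Finite.mem_toFinset]
    refine ⟨sub_mem hv.1 hu, hsubP _ ?_⟩
    have h1 := Metric.mem_ball.1 hv.2
    have h2 := dist_triangle (v - u) v c
    rw [dist_eq_norm (v - u) v, sub_sub_cancel_left, norm_neg] at h2
    linarith
  have hBQ : B ⊆ Q := by
    intro v hv
    rw [hB, Finset.mem_map] at hv
    obtain ⟨x, hx, rfl⟩ := hv
    rw [hA, Set.Finite.mem_toFinset] at hx
    rw [hQ, Set.Finite.mem_toFinset]
    refine ⟨add_mem hx.1 hu, Metric.mem_ball.2 ?_⟩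
    have h1 := hsubQ x hx.2
    have h2 := dist_triangle (x + u) x c
    rw [dist_eq_norm (x + u) x, add_sub_cancel_left] at h2
    change dist (x + u) c < _
    linarith
  -- By `fract_add_eq_ite` the indicator is `(1 - ⟨φ u⟩) + ⟨φ (v + u)⟩ - ⟨φ v⟩`; summed over `A`,
  -- the last two terms become the sum over `B = A + u` minus the sum over `A`.
  have hcount : ({v ∈ (L : Set E) | perturb φ δ v ∈ Metric.ball c ρ ∧
      Int.fract (φ v) < 1 - Int.fract (φ u)}.ncard : ℝ) =
      (1 - Int.fract (φ u)) * A.card +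
        (∑ v ∈ B, Int.fract (φ v) - ∑ v ∈ A, Int.fract (φ v)) := by
    have hset : {v ∈ (L : Set E) | perturb φ δ v ∈ Metric.ball c ρ ∧
        Int.fract (φ v) < 1 - Int.fract (φ u)} =
        (A.filter fun v => Int.fract (φ v) < 1 - Int.fract (φ u) : Finset E) := by
      ext v
      simp [hA, and_assoc]
    rw [hset, Set.ncard_coe_finset, Finset.card_filter, hB, Finset.sum_map,
      ← Finset.sum_sub_distrib, mul_comm, ← nsmul_eq_mul, ← Finset.sum_const,
      ← Finset.sum_add_distrib, Nat.cast_sum]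
    refine Finset.sum_congr rfl fun v _ => ?_
    rw [addRightEmbedding_apply, fract_add_eq_ite]
    split_ifs <;> push_cast <;> ring
  have hdiff := abs_sum_sub_sum_le (f := fun v => Int.fract (φ v))
    (fun v => Int.fract_nonneg _) (fun v => (Int.fract_lt_one _).le) hPB hBQ hPA hAQ
  have hQκ : Q.card * κ ≤ ballVolume E (ρ + (w + D)) := by
    rw [← add_assoc]
    refine (hbounds Q c (ρ + w)).1 ?_
    rw [hQ, Set.Finite.coe_toFinset]
    exact fun v hv => hv
  have hPκ : ballVolume E (ρ - (w + D)) ≤ P.card * κ := by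
    rw [← sub_sub]
    refine (hbounds P c (ρ - w)).2 ?_
    rw [hP, Set.Finite.coe_toFinset]
    exact fun v hv => hv
  have hPAc : (P.card : ℝ) ≤ A.card := by exact_mod_cast Finset.card_le_card hPA
  have hAQc : (A.card : ℝ) ≤ Q.card := by exact_mod_cast Finset.card_le_card hAQ
  have hwD : 0 ≤ w + D := by positivity
  have hV1 : ballVolume E ρ ≤ ballVolume E (ρ + (w + D)) := ballVolume_mono (by linarith)
  have hV2 : ballVolume E (ρ - (w + D)) ≤ ballVolume E ρ := ballVolume_mono (by linarith)
  set S := ballVolume E (ρ + (w + D)) - ballVolume E (ρ - (w + D)) with hS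
  set d := ∑ v ∈ B, Int.fract (φ v) - ∑ v ∈ A, Int.fract (φ v) with hd
  have e1 : |κ * d| ≤ S := by
    rw [abs_mul, abs_of_pos hκ]
    have := mul_le_mul_of_nonneg_left hdiff hκ.le
    linarith
  have e2 : |A.card * κ - ballVolume E ρ| ≤ S := by
    have := mul_le_mul_of_nonneg_right hPAc hκ.le
    have := mul_le_mul_of_nonneg_right hAQc hκ.le
    rw [abs_le]
    constructor <;> linarith
  have e3 : |(1 - Int.fract (φ u)) * (A.card * κ - ballVolume E ρ)| ≤ S := by
    rw [abs_mul]
    refine (mul_le_of_le_one_left (abs_nonneg _) ?_).trans e2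
    have := Int.fract_nonneg (φ u)
    have := Int.fract_lt_one (φ u)
    rw [abs_le]
    constructor <;> linarith
  rw [hcount]
  calc _ = |κ * d + (1 - Int.fract (φ u)) * (A.card * κ - ballVolume E ρ)| := by
        congr 1
        ring
    _ ≤ _ := (abs_add_le _ _).trans (by linarith)

variable {φ δ}

/-- The number of lattice vectors `v` with `⟨φ v⟩` between two thresholds and displaced position in
a ball. -/
theorem exists_abs_ncard_Ico_sub_le : ∃ κ > 0, ∀ s t, s < t →
    IsThreshold (Submodule.span ℤ (Set.range b)) φ s →
    IsThreshold (Submodule.span ℤ (Set.range b)) φ t →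
    ∃ w, ∀ (c : E) (ρ : ℝ),
      |κ * ({v ∈ (Submodule.span ℤ (Set.range b) : Set E) | perturb φ δ v ∈ Metric.ball c ρ ∧
        s ≤ Int.fract (φ v) ∧ Int.fract (φ v) < t}.ncard : ℝ) - (t - s) * ballVolume E ρ| ≤
      4 * (ballVolume E (ρ + w) - ballVolume E (ρ - w)) := by
  obtain ⟨κ, hκ, hcount⟩ := exists_abs_ncard_sub_le b φ δ
  set L := Submodule.span ℤ (Set.range b)
  refine ⟨κ, hκ, fun s t hst hs ht => ?_⟩
  obtain ⟨w₁, hw₁, h₁⟩ := hcount s hs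
  obtain ⟨w₂, hw₂, h₂⟩ := hcount t ht
  refine ⟨w₁ + w₂, fun c ρ => ?_⟩
  have hdiff : {v ∈ (L : Set E) | perturb φ δ v ∈ Metric.ball c ρ ∧
      s ≤ Int.fract (φ v) ∧ Int.fract (φ v) < t} =
      {v ∈ (L : Set E) | perturb φ δ v ∈ Metric.ball c ρ ∧ Int.fract (φ v) < t} \
      {v ∈ (L : Set E) | perturb φ δ v ∈ Metric.ball c ρ ∧ Int.fract (φ v) < s} := by
    ext v
    simp only [Set.mem_sdiff, Set.mem_ofPred_eq, not_and, not_lt]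
    tauto
  have hsub : {v ∈ (L : Set E) | perturb φ δ v ∈ Metric.ball c ρ ∧ Int.fract (φ v) < s} ⊆
      {v ∈ (L : Set E) | perturb φ δ v ∈ Metric.ball c ρ ∧ Int.fract (φ v) < t} :=
    fun v hv => ⟨hv.1, hv.2.1, hv.2.2.trans hst⟩
  have hfin : {v ∈ (L : Set E) | perturb φ δ v ∈ Metric.ball c ρ ∧ Int.fract (φ v) < t}.Finite := by
    refine (finite_span_inter_ball b c (ρ + ‖δ‖)).subset fun v hv => ⟨hv.1, ?_⟩
    have h1 := dist_perturb_le (φ := φ) (δ := δ) v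
    have h2 := dist_triangle v (perturb φ δ v) c
    have h3 := Metric.mem_ball.1 hv.2.1
    rw [dist_comm] at h1
    rw [Metric.mem_ball]
    linarith
  have hcard := Set.ncard_sdiff_add_ncard_of_subset hsub hfin
  rw [← hdiff] at hcard
  have hcard' := congrArg (Nat.cast (R := ℝ)) hcard
  push_cast at hcard'
  have h₁' := h₁ c ρ
  have h₂' := h₂ c ρ
  have := ballVolume_mono (E := E) (by linarith : ρ + w₁ ≤ ρ + (w₁ + w₂))
  have := ballVolume_mono (E := E) (by linarith : ρ + w₂ ≤ ρ + (w₁ + w₂))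
  have := ballVolume_mono (E := E) (by linarith : ρ - (w₁ + w₂) ≤ ρ - w₁)
  have := ballVolume_mono (E := E) (by linarith : ρ - (w₁ + w₂) ≤ ρ - w₂)
  rw [eq_sub_of_add_eq hcard', mul_sub]
  rw [abs_le] at h₁' h₂' ⊢
  constructor <;> linarith

variable [Nontrivial E]

theorem IsGeneric.exists_pos_tendstoUniformly
    (hg : IsGeneric (Submodule.span ℤ (Set.range b)) φ δ) {T : ℝ} (hT : 0 < T) {x : E}
    (hx : x ∈ perturb φ δ '' (Submodule.span ℤ (Set.range b) : Set E)) :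
    ∃ f > 0, TendstoUniformly
      (fun (ρ : ℝ) (c : E) =>
        ((patchClass (perturb φ δ '' (Submodule.span ℤ (Set.range b) : Set E)) T x ∩
          Metric.ball c ρ).ncard : ℝ) / (volume (Metric.ball c ρ)).toReal)
      (fun _ => f) atTop := by
  obtain ⟨κ, hκ, hcount⟩ := exists_abs_ncard_Ico_sub_le (φ := φ) (δ := δ) b
  obtain ⟨u, hu, rfl⟩ := hx
  obtain ⟨s, t, hst, hs, ht, hiff⟩ := exists_sameSide_iff (φ := φ) (δ := δ) b hT u
  obtain ⟨w, hw⟩ := hcount s t hst hs ht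
  refine ⟨(t - s) / κ, div_pos (sub_pos.2 hst) hκ, ?_⟩
  rw [hg.patchClass_eq hu]
  simp only [hiff]
  set L := Submodule.span ℤ (Set.range b)
  rw [Metric.tendstoUniformly_iff]
  intro ε hε
  have hlim := ((tendsto_ballVolume_shell (E := E) w).const_mul (4 / κ))
  rw [mul_zero] at hlim
  filter_upwards [hlim.eventually_lt_const hε, eventually_gt_atTop 0] with ρ hρ hρ0 c
  have hncard : (perturb φ δ '' {v ∈ (L : Set E) | s ≤ Int.fract (φ v) ∧ Int.fract (φ v) < t} ∩
      Metric.ball c ρ).ncard = {v ∈ (L : Set E) | perturb φ δ v ∈ Metric.ball c ρ ∧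
        s ≤ Int.fract (φ v) ∧ Int.fract (φ v) < t}.ncard := by
    rw [← (hg.injOn_perturb.mono (Set.sep_subset _ _)).ncard_image]
    congr 1
    ext y
    constructor
    · rintro ⟨⟨v, ⟨hv, hv'⟩, rfl⟩, hy⟩
      exact ⟨v, ⟨hv, hy, hv'⟩, rfl⟩
    · rintro ⟨v, ⟨hv, hy, hv'⟩, rfl⟩
      exact ⟨⟨v, ⟨hv, hv'⟩, rfl⟩, hy⟩
  have hV := ballVolume_pos (E := E) hρ0
  have hb := hw c ρ
  rw [hncard, ← measureReal_def, measureReal_ball, dist_comm, Real.dist_eq]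
  refine lt_of_le_of_lt ?_ hρ
  set N : ℝ := _
  set V := ballVolume E ρ
  calc |N / V - (t - s) / κ| = |κ * N - (t - s) * V| / (κ * V) := by
        rw [← abs_of_pos (mul_pos hκ hV), ← abs_div]
        congr 1
        field_simp
    _ ≤ 4 * (ballVolume E (ρ + w) - ballVolume E (ρ - w)) / (κ * V) := by gcongr
    _ = _ := by field_simp

theorem IsGeneric.hasUniformPatchFrequencies
    (hg : IsGeneric (Submodule.span ℤ (Set.range b)) φ δ) :
    HasUniformPatchFrequencies (perturb φ δ '' (Submodule.span ℤ (Set.range b) : Set E)) :=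
  fun _ hT _ hx =>
    let ⟨f, _, hf⟩ := hg.exists_pos_tendstoUniformly b hT hx
    ⟨f, hf⟩

theorem IsGeneric.isRepetitive (hg : IsGeneric (Submodule.span ℤ (Set.range b)) φ δ) :
    IsRepetitive (perturb φ δ '' (Submodule.span ℤ (Set.range b) : Set E)) := by
  intro T hT
  have hfin := hg.finite_patchClass_image b T
  set Z := perturb φ δ '' (Submodule.span ℤ (Set.range b) : Set E) with hZ
  have hdense : ∀ C ∈ patchClass Z T '' Z, ∃ ρ : ℝ, ∀ c, ∃ y ∈ C, dist y c ≤ ρ := by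
    rintro _ ⟨x, hx, rfl⟩
    obtain ⟨f, hf, hlim⟩ := hg.exists_pos_tendstoUniformly b hT hx
    -- With tolerance `f` itself, a ball without occurrences would deviate by exactly `f`, which is
    -- not allowed.
    obtain ⟨ρ, hρ⟩ := (Metric.tendstoUniformly_iff.1 hlim f hf).exists
    refine ⟨ρ, fun c => ?_⟩
    have h := hρ c
    rcases (patchClass Z T x ∩ Metric.ball c ρ).eq_empty_or_nonempty with he | ⟨y, hy, hyc⟩
    · rw [he, Set.ncard_empty, Nat.cast_zero, zero_div, dist_zero_right,
        Real.norm_of_nonneg hf.le] at h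
      exact absurd h (lt_irrefl f)
    · exact ⟨y, hy, (Metric.mem_ball.1 hyc).le⟩
  -- The radius is chosen per class rather than per point, so finitely many classes give a common
  -- bound.
  choose! R hR using hdense
  obtain ⟨M, hM⟩ := (hfin.image R).bddAbove
  refine lt_of_le_of_lt (sInf_le (a := ENNReal.ofReal M) fun c x hx => ?_) ENNReal.ofReal_lt_top
  have hC := Set.mem_image_of_mem (patchClass Z T) hx
  obtain ⟨y, hy, hyc⟩ := hR _ hC c
  refine ⟨y, hy, ?_⟩
  rw [edist_dist]
  exact ENNReal.ofReal_le_ofReal (hyc.trans (hM (Set.mem_image_of_mem R hC)))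

end Counting

end Delone

theorem theorem6p3 (n : ℕ) (hn : 1 ≤ n) (ε : ℝ) (hε : 0 < ε) :
    (∃ X : Set (EuclideanSpace ℝ (Fin n)),
      Delone.IsDelone X ∧ Delone.IsAperiodic X ∧
      ∃ T : ℝ, 0 < T ∧
        (Delone.patchCount X T : ℝ≥0∞) <
          ENNReal.ofReal ((Delone.kappa n / 2 + ε) * (T / (Delone.coveringRadius X).toReal)) ∧
        Delone.repetitivity X T < ENNReal.ofReal ((Delone.kappa n / 2 + ε) * T)) ∧
    (∃ Z : Set (EuclideanSpace ℝ (Fin n)),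
      Delone.IsMeyer Z ∧ Delone.IsAperiodic Z ∧ Delone.IsRepetitive Z ∧
      Delone.HasUniformPatchFrequencies Z ∧
      Delone.IsPerturbedLattice Z ∧ Delone.IsCutAndProject Z ∧
      ∃ T : ℝ, 0 < T ∧
        (Delone.patchCount Z T : ℝ≥0∞) <
          ENNReal.ofReal ((Delone.kappaL n / 2 + ε) * (T / (Delone.coveringRadius Z).toReal)) ∧
        Delone.repetitivity Z T < ENNReal.ofReal ((Delone.kappaL n / 2 + ε) * T)) := by
  have hpos : 0 < n := hn
  have : NeZero n := ⟨hpos.ne'⟩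
  have hfinrank : Module.finrank ℝ (EuclideanSpace ℝ (Fin n)) = n := finrank_euclideanSpace_fin
  have : Nontrivial (EuclideanSpace ℝ (Fin n)) :=
    Module.nontrivial_of_finrank_pos (R := ℝ) (by rwa [hfinrank])
  have : NeZero (Module.finrank ℝ (EuclideanSpace ℝ (Fin n))) := ⟨by rw [hfinrank]; exact hpos.ne'⟩
  let b₀ := Module.finBasis ℝ (EuclideanSpace ℝ (Fin n))
  constructor
  · obtain ⟨_, ⟨X, hX, rfl⟩, hk⟩ := exists_lt_of_csInf_lt
      (s := {k : ℝ | ∃ X : Set (EuclideanSpace ℝ (Fin n)),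
        Delone.IsDelone X ∧ k = Delone.packingCoveringRatio X})
      ⟨_, _, Delone.isDelone_span_range b₀, rfl⟩
      (show Delone.kappa n < 2 * (Delone.kappa n / 2 + ε) by linarith)
    obtain ⟨Y, hY, hYk, hYa⟩ := hX.exists_isAperiodic hk
    exact ⟨Y, hY, hYa, hY.exists_patchCount_lt_and_repetitivity_lt hYk⟩
  · obtain ⟨_, ⟨L, hL, rfl⟩, hk⟩ := exists_lt_of_csInf_lt
      (s := {k : ℝ | ∃ L : Submodule ℤ (EuclideanSpace ℝ (Fin n)), Delone.IsLattice L ∧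
        k = Delone.packingCoveringRatio (L : Set (EuclideanSpace ℝ (Fin n)))})
      ⟨_, _, Delone.isLattice_span_range b₀, rfl⟩
      (show Delone.kappaL n < 2 * (Delone.kappaL n / 2 + ε) by linarith)
    -- The tolerance `η` is fixed before `δ`, which is then taken with `‖δ‖ ≤ η`.
    obtain ⟨η, hη, hpert⟩ := hL.isDelone.exists_perturbation hk
    obtain ⟨b, rfl⟩ := hL.exists_basis
    obtain ⟨φ, δ, hδ, hg⟩ := Delone.exists_isGeneric b hη
    obtain ⟨hZ, hZk⟩ := hpert (Delone.perturb φ δ)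
      fun v _ => (Delone.dist_perturb_le v).trans hδ
    exact ⟨_, Delone.isMeyer_image_perturb b hZ, hg.isAperiodic, hg.isRepetitive b,
      hg.hasUniformPatchFrequencies b, Delone.isPerturbedLattice_image_perturb hL,
      hg.isCutAndProject b, hZ.exists_patchCount_lt_and_repetitivity_lt hZk⟩
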